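/- Let $q\ge 2$, let $T=T_{q+1}$ be the $(q+1)$-homogeneous tree with distinguished vertex $v_0$ and let $\partial T$ be its space of ends. The dynamic graph $\Gamma$ of $T$ is the $\mathbb N$-graded graph whose $n$th level is a copy of the set of vertices of $T$ connected with $v_0$ by a walk of length $n$ (the only vertex of level $0$ is denoted by $\varnothing$); two vertices of $\Gamma$ are adjacent if and only if they lie at adjacent levels and are adjacent in $T$. Let $\pi$ be the projection of $\Gamma$ to $T$. A Borel probability measure on the space of infinite paths $(w_0=\varnothing,w_1,w_2,\dots)$ in $\Gamma$ is called central if for every vertex $v$ of $\Gamma$ the conditional measure on the set of finite paths from $\varnothing$ to $v$ is uniform, and a central measure is called ergodic if it is an extreme point of the convex set of central measures. For $\omega\in\partial T$ and $r\in[0,1]$ let $\lambda_{\omega,r}$ be the Markov measure on this space whose transition probability on an edge $(v,w)$ is $r$ if $\pi(w)$ lies between $\pi(v)$ and $\omega$, and $\frac{1-r}{q}$ otherwise. Then for all $\omega\in\partial T$ and $r\in[0,1]$ the measure $\lambda_{\omega,r}$ is central, and it is ergodic if and only if $r\in[1/2,1]$. Moreover: (a) if $r<1/2$, then for $\lambda_{\omega,r}$-almost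 every path $w$ the sequence $\pi(w_n)$ converges to a (random) end other than $\omega$, and the distribution of this end on $\partial T$ is continuous (has no atoms); (b) if $r\ge 1/2$, then for $\lambda_{\omega,r}$-almost every path $w$ the sequence $\pi(w_n)$ converges to $\omega$ with rate $2r-1$, i.e. $d\bigl(\pi(w_n),v_{\lfloor(2r-1)n\rfloor}\bigr)/n\to0$ as $n\to\infty$, where $v_k$ is the vertex at distance $k$ from $v_0$ on the ray from $v_0$ to $\omega$. Here a sequence $x_i$ of vertices converges to an end $\xi$ if for every vertex $v$ the length of the common part of the geodesic segment $[v,x_i]$ and of the ray from $v$ to $\xi$ tends to infinity. -/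

import Mathlib

open MeasureTheory ProbabilityTheory Filter Topology
open scoped ENNReal NNReal

namespace DynamicGraph

universe u

/-! ## Homogeneous trees and their ends -/

section Ends

/-- `G` is the homogeneous tree of valency `q + 1`. -/
structure IsHomogeneousTree {V : Type u} (G : SimpleGraph V) [G.LocallyFinite] (q : ℕ) :
    Prop where
  isTree : G.IsTree
  regular : G.IsRegularOfDegree (q + 1)

/-- A ray of `G`: a one-sided infinite path without repeated vertices. -/
structure Ray {V : Type u} (G : SimpleGraph V) where
  toFun : ℕ → V
  adj : ∀ n, G.Adj (toFun n) (toFun (n + 1))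
  inj : Function.Injective toFun

instance {V : Type u} (G : SimpleGraph V) : CoeFun (Ray G) (fun _ => ℕ → V) := ⟨Ray.toFun⟩

/-- Two rays are equivalent if they eventually coincide (up to a shift of the numbering). -/
instance Ray.setoid {V : Type u} (G : SimpleGraph V) : Setoid (Ray G) where
  r ρ σ := ∃ m n : ℕ, ∀ k, ρ (m + k) = σ (n + k)
  iseqv :=
    { refl := fun _ => ⟨0, 0, fun _ => rfl⟩
      symm := fun ⟨m, n, h⟩ => ⟨n, m, fun k => (h k).symm⟩
      trans := by
        rintro ρ σ τ ⟨m, n, h⟩ ⟨m', n', h'⟩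
        refine ⟨m + m', n' + n, fun k => ?_⟩
        have h1 := h (m' + k)
        have h2 := h' (n + k)
        rw [show m + m' + k = m + (m' + k) by ring, h1,
          show n + (m' + k) = m' + (n + k) by ring, h2,
          show n' + n + k = n' + (n + k) by ring] }

/-- The ends of a tree: equivalence classes of rays. -/
def Ends {V : Type u} (G : SimpleGraph V) : Type u := Quotient (Ray.setoid G)

/-- The ray `ρ` represents the end `ω`; if `G` is a tree, `ρ` is then the
geodesic ray `[ρ 0, ω⟩`. -/
def Ray.Represents {V : Type u} {G : SimpleGraph V} (ρ : Ray G) (ω : Ends G) : Prop :=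
  (Quotient.mk (Ray.setoid G) ρ : Ends G) = ω

/-- `y` is the neighbour of `x` that lies between `x` and the end `ω`, i.e. the edge `(x, y)` is
`ω`-directed: `y` is the second vertex of the ray `[x, ω⟩`. -/
def Directed {V : Type u} {G : SimpleGraph V} (ω : Ends G) (x y : V) : Prop :=
  ∃ ρ : Ray G, ρ.Represents ω ∧ ρ 0 = x ∧ ρ 1 = y

/-- The usual topology of the space of ends of a tree, generated by the sets of all ends
that lie behind a given directed edge `(x, y)`. -/
instance {V : Type u} (G : SimpleGraph V) : TopologicalSpace (Ends G) :=
  TopologicalSpace.generateFrom {S | ∃ x y : V, S = {ξ | Directed ξ x y}}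

/-- The Borel σ-algebra on the space of ends. -/
instance {V : Type u} (G : SimpleGraph V) : MeasurableSpace (Ends G) := borel _

/-- The vertex `u` lies on the geodesic segment `[a, b]`. -/
def OnGeodesic {V : Type u} (G : SimpleGraph V) (a b u : V) : Prop :=
  G.dist a u + G.dist u b = G.dist a b

/-- The length of the common part of the geodesic segment `[v, x]` and the ray `[v, ω⟩`, where
`ρ` is the ray `[v, ω⟩`. -/
noncomputable def commonLength {V : Type u} {G : SimpleGraph V} (ρ : Ray G) (x : V) : ℕ :=
  sSup {k | OnGeodesic G (ρ 0) x (ρ k)}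

/-- The sequence `x` of vertices converges to the end `ω`: for every vertex `v`, the length of
`[v, x i] ∩ [v, ω⟩` tends to infinity. -/
def ConvergesTo {V : Type u} {G : SimpleGraph V} (x : ℕ → V) (ω : Ends G) : Prop :=
  ∀ ρ : Ray G, ρ.Represents ω → Tendsto (fun i => commonLength ρ (x i)) atTop atTop

end Ends

/-! ## The dynamic graph, its paths, central and ergodic measures -/

section Paths

/-- The `n`th level of the dynamic graph of `(G, v₀)`: a copy of the set of those vertices that
are connected with `v₀` by a walk of length `n`. -/
def levelSet {V : Type u} (G : SimpleGraph V) (v₀ : V) (n : ℕ) : Set V :=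
  {v | ∃ p : G.Walk v₀ v, p.length = n}

/-- The type of vertices of the `n`th level of the dynamic graph. The coercion to `V` is the natural
projection of the dynamic graph to `G`. -/
abbrev Level {V : Type u} (G : SimpleGraph V) (v₀ : V) (n : ℕ) : Type u := ↥(levelSet G v₀ n)

/-- The unique vertex of level zero. -/
def root {V : Type u} (G : SimpleGraph V) (v₀ : V) : Level G v₀ 0 :=
  ⟨v₀, SimpleGraph.Walk.nil, rfl⟩

/-- The (finite) levels are discrete. -/
instance Level.measurableSpace {V : Type u} (G : SimpleGraph V) (v₀ : V) (n : ℕ) :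
    MeasurableSpace (Level G v₀ n) := ⊤

instance Level.discrete {V : Type u} (G : SimpleGraph V) (v₀ : V) (n : ℕ) :
    DiscreteMeasurableSpace (Level G v₀ n) := ⟨fun _ => trivial⟩

/-- The sequences of vertices of consecutive levels that are infinite paths. -/
def pathSet {V : Type u} (G : SimpleGraph V) (v₀ : V) : Set (∀ n, Level G v₀ n) :=
  {w | ∀ n, G.Adj (w n).1 (w (n + 1)).1}

/-- The space of infinite paths `(w₀ = ∅, w₁, w₂, …)` in the dynamic graph of `(G, v₀)`, with the
σ-algebra generated by the coordinates (the Borel σ-algebra of the product topology). -/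
abbrev Paths {V : Type u} (G : SimpleGraph V) (v₀ : V) : Type u := ↥(pathSet G v₀)

/-- The projection of an infinite path to `G`. -/
def proj {V : Type u} {G : SimpleGraph V} {v₀ : V} (w : Paths G v₀) (n : ℕ) : V := (w.1 n).1

/-- The set of infinite paths that start with the finite path `(w₀, …, wₙ)`. -/
def pathCylinder {V : Type u} {G : SimpleGraph V} {v₀ : V} (w : Paths G v₀) (n : ℕ) :
    Set (Paths G v₀) :=
  {w' | ∀ k ≤ n, w'.1 k = w.1 k}

/-- A Borel probability measure on the path space is central if for every vertex `v` of the dynamic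
graph, all finite paths from `∅` to `v` have the same probability, i.e. the conditional measure on
the finite set of these paths is uniform. (Every finite path is an initial segment of an
infinite one, since it can be continued by going back and forth along an edge.) -/
structure IsCentral {V : Type u} {G : SimpleGraph V} {v₀ : V} (μ : Measure (Paths G v₀)) :
    Prop where
  prob : IsProbabilityMeasure μ
  uniform : ∀ (n : ℕ) (w w' : Paths G v₀), w.1 n = w'.1 n → μ (pathCylinder w n) = μ (pathCylinder w' n)

/-- A central measure is ergodic if it is an extreme point of the convex set of central measures. -/
def IsErgodic {V : Type u} {G : SimpleGraph V} {v₀ : V} (μ : Measure (Paths G v₀)) : Prop :=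
  μ ∈ Set.extremePoints ℝ≥0 {ν : Measure (Paths G v₀) | IsCentral ν}

end Paths

/-! ## The Markov measures -/

section Transitions

/-- A segment of a ray is a path. -/
theorem Ray.exists_path {V : Type u} {G : SimpleGraph V} (ρ : Ray G) (k : ℕ) :
    ∀ i e : ℕ, e = i + k → ∃ p : G.Walk (ρ i) (ρ e), p.IsPath ∧ p.length = k ∧
      (∀ u ∈ p.support, ∃ j, i ≤ j ∧ u = ρ j) ∧ (1 ≤ k → p.getVert 1 = ρ (i + 1)) := by
  induction k with
  | zero =>
    intro i e he
    obtain rfl : e = i := by simpa using he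
    exact ⟨SimpleGraph.Walk.nil, by simp, by simp,
      fun u hu => ⟨e, le_rfl, by simpa using hu⟩, by simp⟩
  | succ k ih =>
    intro i e he
    obtain ⟨p, hp, hl, hs, -⟩ := ih (i + 1) e (by omega)
    refine ⟨SimpleGraph.Walk.cons (ρ.adj i) p, ?_, by simp [hl], ?_, by simp⟩
    · rw [SimpleGraph.Walk.cons_isPath_iff]
      refine ⟨hp, fun h => ?_⟩
      obtain ⟨j, hj, hj'⟩ := hs _ h
      have := ρ.inj hj'
      omega
    · intro u hu
      rw [SimpleGraph.Walk.support_cons, List.mem_cons] at hu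
      rcases hu with rfl | hu
      · exact ⟨i, le_rfl, rfl⟩
      · obtain ⟨j, hj, rfl⟩ := hs u hu
        exact ⟨j, by omega, rfl⟩

/-- Equivalent rays of a tree that start at the same vertex have the same second vertex. -/
theorem Ray.second_eq {V : Type u} {G : SimpleGraph V} (hG : G.IsTree) {ω : Ends G} {ρ σ : Ray G}
    (hρ : ρ.Represents ω) (hσ : σ.Represents ω) (h0 : ρ 0 = σ 0) : ρ 1 = σ 1 := by
  obtain ⟨m, n, h⟩ : ρ ≈ σ := Quotient.exact (hρ.trans hσ.symm)
  obtain ⟨p, hp, -, -, hp1⟩ := ρ.exists_path (m + 1) 0 (m + 1) (by omega)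
  obtain ⟨p', hp', -, -, hp1'⟩ := σ.exists_path (n + 1) 0 (n + 1) (by omega)
  have he := h 1
  have key : p = p'.copy h0.symm he.symm := by
    have := (hG.isAcyclic.subsingleton_path (ρ 0) (ρ (m + 1))).elim ⟨p, hp⟩
      ⟨p'.copy h0.symm he.symm, (SimpleGraph.Walk.isPath_copy _ _ _).2 hp'⟩
    exact congrArg Subtype.val this
  have h1 : p.getVert 1 = p'.getVert 1 := by
    rw [key, SimpleGraph.Walk.getVert_copy]
  rw [hp1 (by omega), hp1' (by omega)] at h1
  exact h1

/-- In a tree, every end is represented by a ray starting at any given vertex. -/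
theorem exists_ray {V : Type u} {G : SimpleGraph V} (hG : G.IsTree) (ω : Ends G) (x : V) :
    ∃ ρ : Ray G, ρ.Represents ω ∧ ρ 0 = x := by
  have step : ∀ x y : V, G.Adj x y → (∃ ρ : Ray G, ρ.Represents ω ∧ ρ 0 = x) →
      ∃ ρ : Ray G, ρ.Represents ω ∧ ρ 0 = y := by
    rintro x y hxy ⟨ρ, hρ, rfl⟩
    by_cases hy : ∃ j, ρ j = y
    · obtain ⟨j, rfl⟩ := hy
      refine ⟨⟨fun n => ρ (j + n), fun n => ρ.adj (j + n), fun a b hab => ?_⟩, ?_, rfl⟩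
      · have := ρ.inj hab
        omega
      · rw [← hρ]
        exact Quotient.sound ⟨0, j, fun k => by simp⟩
    · push Not at hy
      refine ⟨⟨fun n => Nat.casesOn n y ρ, fun n => ?_, fun a b hab => ?_⟩, ?_, rfl⟩
      · cases n with
        | zero => exact hxy.symm
        | succ n => exact ρ.adj n
      · cases a with
        | zero =>
          cases b with
          | zero => rfl
          | succ b => exact absurd hab.symm (hy b)
        | succ a =>
          cases b with
          | zero => exact absurd hab (hy a)
          | succ b => exact congrArg Nat.succ (ρ.inj hab)
      · rw [← hρ]
        refine Quotient.sound ⟨1, 0, fun k => ?_⟩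
        change (Nat.casesOn (1 + k) y ρ : V) = ρ (0 + k)
        rw [Nat.add_comm 1 k, Nat.zero_add]
  obtain ⟨σ, hσ⟩ := Quotient.exists_rep ω
  obtain ⟨p⟩ := hG.connected.preconnected (σ 0) x
  have : ∀ a b : V, G.Walk a b → (∃ ρ : Ray G, ρ.Represents ω ∧ ρ 0 = a) →
      ∃ ρ : Ray G, ρ.Represents ω ∧ ρ 0 = b := by
    intro a b p
    induction p with
    | nil => exact id
    | cons h p ih => exact fun ha => ih (step _ _ h ha)
  exact this _ _ p ⟨σ, hσ, rfl⟩

/-- In a tree, there is a unique neighbour of `x` that lies between `x` and `ω`. -/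
theorem existsUnique_directed {V : Type u} {G : SimpleGraph V} (hG : G.IsTree) (ω : Ends G)
    (x : V) : ∃! y, Directed ω x y := by
  obtain ⟨ρ, hρ, h0⟩ := exists_ray hG ω x
  refine ⟨ρ 1, ⟨ρ, hρ, h0, rfl⟩, ?_⟩
  rintro y ⟨σ, hσ, hσ0, rfl⟩
  exact Ray.second_eq hG hσ hρ (hσ0.trans h0.symm)

theorem Directed.adj {V : Type u} {G : SimpleGraph V} {ω : Ends G} {x y : V}
    (h : Directed ω x y) : G.Adj x y := by
  obtain ⟨ρ, -, rfl, rfl⟩ := h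
  exact ρ.adj 0

open Classical in
/-- The transition probabilities: `r` on the `ω`-directed edges and `(1 - r) / q` on all
other edges. -/
noncomputable def transProb {V : Type u} {G : SimpleGraph V} (q : ℕ) (ω : Ends G) (r : ℝ)
    (x y : V) : ℝ≥0∞ :=
  if G.Adj x y then ENNReal.ofReal (if Directed ω x y then r else (1 - r) / q) else 0

open Classical in
theorem tsum_transProb {V : Type u} {G : SimpleGraph V} [G.LocallyFinite] {q : ℕ}
    (hG : IsHomogeneousTree G q) (hq : 2 ≤ q) (ω : Ends G) (r : unitInterval) (x : V) :
    ∑' y, transProb q ω r x y = 1 := by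
  obtain ⟨y₀, hy₀, huniq⟩ := existsUnique_directed hG.isTree ω x
  have hmem : y₀ ∈ G.neighborFinset x := by simpa using hy₀.adj
  have hzero : ∀ y ∉ G.neighborFinset x, transProb q ω r x y = 0 :=
    fun y hy => if_neg (by simpa using hy)
  rw [tsum_eq_sum hzero,
    ← Finset.add_sum_erase _ _ hmem, Finset.sum_congr rfl (g := fun _ =>
      ENNReal.ofReal ((1 - r) / q)), Finset.sum_const, Finset.card_erase_of_mem hmem,
    SimpleGraph.card_neighborFinset_eq_degree, hG.regular x]
  · have h1 : transProb q ω r x y₀ = ENNReal.ofReal r := by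
      simp [transProb, hy₀.adj, hy₀]
    have hq0 : (0 : ℝ) < q := by positivity
    rw [h1, Nat.add_sub_cancel, nsmul_eq_mul, ← ENNReal.ofReal_natCast,
      ← ENNReal.ofReal_mul hq0.le, mul_div_cancel₀ _ hq0.ne',
      ← ENNReal.ofReal_add r.2.1 (by linarith [r.2.2])]
    simp
  · intro y hy
    rw [Finset.mem_erase, SimpleGraph.mem_neighborFinset] at hy
    have : ¬ Directed ω x y := fun h => hy.1 (huniq y h)
    simp [transProb, hy.2, this]

/-- The law of the vertex of level `n + 1` that follows a given vertex `v` of level `n`. -/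
noncomputable def step {V : Type u} {G : SimpleGraph V} [G.LocallyFinite] {q : ℕ}
    (hG : IsHomogeneousTree G q) (hq : 2 ≤ q) (v₀ : V) (ω : Ends G) (r : unitInterval) (n : ℕ)
    (v : Level G v₀ n) : PMF (Level G v₀ (n + 1)) :=
  ⟨fun y => transProb q ω r v.1 y.1, by
    have h : ∑' y : Level G v₀ (n + 1), transProb q ω r v.1 y.1 = 1 := by
      rw [← tsum_transProb hG hq ω r v.1]
      refine tsum_subtype_eq_of_support_subset (f := transProb q ω r v.1) fun y hy => ?_
      have hadj : G.Adj v.1 y := by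
        by_contra hne
        exact hy (if_neg hne)
      obtain ⟨p, hp⟩ := v.2
      exact ⟨p.concat hadj, by simp [hp]⟩
    rw [← h]
    exact ENNReal.summable.hasSum⟩

/-- The transition kernel from level `n` to level `n + 1`; it depends on the past
only through the vertex of level `n`. -/
noncomputable def stepKernel {V : Type u} {G : SimpleGraph V} [G.LocallyFinite] {q : ℕ}
    (hG : IsHomogeneousTree G q) (hq : 2 ≤ q) (v₀ : V) (ω : Ends G) (r : unitInterval) (n : ℕ) :
    Kernel ((i : Finset.Iic n) → Level G v₀ i) (Level G v₀ (n + 1)) where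
  toFun w := (step hG hq v₀ ω r n (w ⟨n, Finset.mem_Iic.2 le_rfl⟩)).toMeasure
  measurable' := (Measurable.of_discrete
    (f := fun v => (step hG hq v₀ ω r n v).toMeasure)).comp (measurable_pi_apply _)

instance {V : Type u} {G : SimpleGraph V} [G.LocallyFinite] {q : ℕ}
    (hG : IsHomogeneousTree G q) (hq : 2 ≤ q) (v₀ : V) (ω : Ends G) (r : unitInterval) (n : ℕ) :
    IsMarkovKernel (stepKernel hG hq v₀ ω r n) :=
  ⟨fun w => PMF.toMeasure.isProbabilityMeasure
    (step hG hq v₀ ω r n (w ⟨n, Finset.mem_Iic.2 le_rfl⟩))⟩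

/-- The law, on the sequences of vertices of consecutive levels, of the Markov chain that starts at
`∅` and has the transition probabilities `transProb`. -/
noncomputable def chainLaw {V : Type u} {G : SimpleGraph V} [G.LocallyFinite] {q : ℕ}
    (hG : IsHomogeneousTree G q) (hq : 2 ≤ q) (v₀ : V) (ω : Ends G) (r : unitInterval) :
    Measure (∀ n, Level G v₀ n) :=
  Kernel.trajMeasure (Measure.dirac (root G v₀)) (stepKernel hG hq v₀ ω r)

/-- The Markov measure `λ_{ω,r}` on the space of infinite paths: the law of the Markov chain
restricted to the (measurable, almost sure) set of sequences that are infinite paths. -/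
noncomputable def markovMeasure {V : Type u} {G : SimpleGraph V} [G.LocallyFinite] {q : ℕ}
    (hG : IsHomogeneousTree G q) (hq : 2 ≤ q) (v₀ : V) (ω : Ends G) (r : unitInterval) :
    Measure (Paths G v₀) :=
  (chainLaw hG hq v₀ ω r).comap Subtype.val

end Transitions

end DynamicGraph

/-! Seen from `ω`, every vertex has one parent, its neighbour towards `ω`, and `q` children; the
height goes up by one at each step to a parent and down by one at each step to a child. A finite
path with `a` up-steps and `c` down-steps has weight r^a ((1-r)/q)^c. Its length determines a + c
and its last vertex determines a - c, whence centrality (`exists_prod_transProb_eq`). The up-steps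
are pairwise independent events of probability `r`, so the height divided by `n` tends to 2r - 1
almost surely.

The position relative to a ray or line running to `ω` (a trunk) is controlled by the function q^(-k)
t^j, where `k` is the height at which the ray from a vertex to `ω` reaches the trunk and `j` is the
distance to that point. For suitable `t` it is superharmonic, hence converges along almost every
path (`IsTrunk.ae_exists_tendsto_trunkFun`). If r ≥ 1/2, take t = 1 and the ray from `v₀`: the
heights are unbounded above, so `k` tends to infinity, which is convergence to `ω`; and `k` lies
between the height and its running maximum, which gives the rate. If r < 1/2, the height tends to
-∞, so the path is trapped behind a descending sequence of vertices and converges to an end other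
than `ω`. With t = r/(1-r) and the line from such an end to `ω` as trunk, the function is unbounded
along every path that converges to that end; so the limit law has no atoms.

Ergodicity fails for r < 1/2: the events that the path eventually stays behind a given edge are tail
events, conditioning on a tail event preserves centrality, so an ergodic measure would have an
almost surely constant limit end, that is, an atom.

For r ≥ 1/2, a component of a convex decomposition is a central measure dominated by a multiple of
the Markov measure. Its density on finite paths depends only on the last vertex, by centrality of
both measures, and is a bounded space-time harmonic function if r < 1. Coupling two chains so that
they move up together or down together shows that it depends only on level and height
(`eq_of_iterate_up_eq`): the number of steps until their rays merge performs a walk that does not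
drift away from 0. A bounded space-time harmonic function of the walk on ℤ is constant
(`eq_of_parabolic`), so the density is 1. For r = 1 the chain is deterministic. -/

namespace DynamicGraph

universe u

/-! ### Parents, heights and descendants with respect to an end. -/

section TreeGeometry

variable {V : Type u} {G : SimpleGraph V}

/-- A tail of a ray. -/
def Ray.shift (ρ : Ray G) (m : ℕ) : Ray G where
  toFun k := ρ (m + k)
  adj k := ρ.adj (m + k)
  inj a b hab := by simpa using ρ.inj hab

@[simp] theorem Ray.shift_apply (ρ : Ray G) (m k : ℕ) : ρ.shift m k = ρ (m + k) := rfl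

theorem Ray.Represents.shift {ρ : Ray G} {ω : Ends G} (h : ρ.Represents ω) (m : ℕ) :
    (ρ.shift m).Represents ω := by
  rw [← h]
  exact Quotient.sound ⟨0, m, fun k => by simp⟩

theorem Ray.Represents.directed {ρ : Ray G} {ω : Ends G} (h : ρ.Represents ω) (k : ℕ) :
    Directed ω (ρ k) (ρ (k + 1)) :=
  ⟨ρ.shift k, h.shift k, rfl, rfl⟩

/-- The neighbour of `x` that lies between `x` and the end `ω`. -/
noncomputable def up (hG : G.IsTree) (ω : Ends G) (x : V) : V :=
  (existsUnique_directed hG ω x).choose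

theorem directed_up (hG : G.IsTree) (ω : Ends G) (x : V) : Directed ω x (up hG ω x) :=
  (existsUnique_directed hG ω x).choose_spec.1

theorem directed_iff_eq_up (hG : G.IsTree) {ω : Ends G} {x y : V} :
    Directed ω x y ↔ y = up hG ω x :=
  ⟨fun h => (existsUnique_directed hG ω x).choose_spec.2 y h, fun h => h ▸ directed_up hG ω x⟩

theorem adj_up (hG : G.IsTree) (ω : Ends G) (x : V) : G.Adj x (up hG ω x) :=
  (directed_up hG ω x).adj

theorem Ray.Represents.apply_eq_iterate_up (hG : G.IsTree) {ρ : Ray G} {ω : Ends G}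
    (h : ρ.Represents ω) (k : ℕ) : ρ k = (up hG ω)^[k] (ρ 0) := by
  induction k with
  | zero => rfl
  | succ k ih =>
    rw [Function.iterate_succ_apply', ← ih]
    exact (directed_iff_eq_up hG).1 (h.directed k)

theorem exists_iterate_up_eq (hG : G.IsTree) (ω : Ends G) (x y : V) :
    ∃ m n, (up hG ω)^[m] x = (up hG ω)^[n] y := by
  obtain ⟨ρ, hρ, rfl⟩ := exists_ray hG ω x
  obtain ⟨σ, hσ, rfl⟩ := exists_ray hG ω y
  obtain ⟨m, n, h⟩ : ρ ≈ σ := Quotient.exact (hρ.trans hσ.symm)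
  refine ⟨m, n, ?_⟩
  rw [← hρ.apply_eq_iterate_up hG, ← hσ.apply_eq_iterate_up hG]
  exact h 0

theorem iterate_up_injective (hG : G.IsTree) (ω : Ends G) (x : V) :
    Function.Injective fun k => (up hG ω)^[k] x := by
  obtain ⟨ρ, hρ, rfl⟩ := exists_ray hG ω x
  intro a b hab
  apply ρ.inj
  rw [hρ.apply_eq_iterate_up hG, hρ.apply_eq_iterate_up hG b]
  exact hab

/-- Every edge of a tree is directed towards `ω` in exactly one direction. -/
theorem eq_up_or_up_eq (hG : G.IsTree) (ω : Ends G) {x y : V} (hxy : G.Adj x y) :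
    y = up hG ω x ∨ up hG ω y = x := by
  obtain ⟨ρ, hρ, rfl⟩ := exists_ray hG ω x
  by_cases hy : ∃ j, ρ j = y
  · obtain ⟨j, rfl⟩ := hy
    left
    obtain ⟨p, hp, hl, -, -⟩ := ρ.exists_path j 0 j (by omega)
    have h1 : (hxy.toWalk).IsPath := by simp [hxy.ne]
    have := congrArg Subtype.val ((hG.isAcyclic.subsingleton_path (ρ 0) (ρ j)).elim ⟨p, hp⟩
      ⟨_, h1⟩)
    have hj : j = 1 := by
      rw [← hl]
      simp only at this
      simp [this]
    subst hj
    exact (directed_iff_eq_up hG).1 (hρ.directed 0)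
  · push Not at hy
    right
    let σ : Ray G := ⟨fun n => Nat.casesOn n y ρ, fun n => by
        cases n with
        | zero => exact hxy.symm
        | succ n => exact ρ.adj n, fun a b hab => by
        cases a with
        | zero =>
          cases b with
          | zero => rfl
          | succ b => exact absurd hab.symm (hy b)
        | succ a =>
          cases b with
          | zero => exact absurd hab (hy a)
          | succ b => exact congrArg Nat.succ (ρ.inj hab)⟩
    refine ((directed_iff_eq_up hG).1 ⟨σ, ?_, rfl, rfl⟩).symm
    rw [← hρ]
    refine Quotient.sound ⟨1, 0, fun k => ?_⟩
    change (Nat.casesOn (1 + k) y ρ : V) = ρ (0 + k)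
    rw [Nat.add_comm 1 k, Nat.zero_add]

theorem up_up_ne (hG : G.IsTree) (ω : Ends G) (x : V) : up hG ω (up hG ω x) ≠ x := fun h => by
  have := @iterate_up_injective V G hG ω x 2 0 h
  omega

/-- The height of `x` with respect to `ω` (the Busemann function), normalized to vanish
at `v₀`. -/
noncomputable def height (hG : G.IsTree) (ω : Ends G) (v₀ x : V) : ℤ :=
  ((exists_iterate_up_eq hG ω x v₀).choose_spec.choose : ℤ) -
    (exists_iterate_up_eq hG ω x v₀).choose

/-- Two pairs `(m, n)` and `(m', n')` of this kind give the same vertex at indices `m' + n` and `m +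
n'` of the ray from `v₀`. Iterates of `up` are injective, so the difference does not depend on the
choice made in `height`. -/
theorem height_eq (hG : G.IsTree) (ω : Ends G) {v₀ x : V} {m n : ℕ}
    (h : (up hG ω)^[m] x = (up hG ω)^[n] v₀) : height hG ω v₀ x = n - m := by
  have h' := (exists_iterate_up_eq hG ω x v₀).choose_spec.choose_spec
  unfold height
  generalize (exists_iterate_up_eq hG ω x v₀).choose_spec.choose = n' at *
  generalize (exists_iterate_up_eq hG ω x v₀).choose = m' at *
  have h1 : (up hG ω)^[m' + n] v₀ = (up hG ω)^[m + n'] v₀ := by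
    rw [Function.iterate_add_apply, ← h, Function.iterate_add_apply, ← h',
      ← Function.iterate_add_apply, ← Function.iterate_add_apply, Nat.add_comm]
  have := iterate_up_injective hG ω v₀ h1
  omega

@[simp] theorem height_base (hG : G.IsTree) (ω : Ends G) (v₀ : V) : height hG ω v₀ v₀ = 0 := by
  simpa using height_eq hG ω (v₀ := v₀) (x := v₀) (m := 0) (n := 0) rfl

@[simp] theorem height_up (hG : G.IsTree) (ω : Ends G) (v₀ x : V) :
    height hG ω v₀ (up hG ω x) = height hG ω v₀ x + 1 := by
  obtain ⟨m, n, h⟩ := exists_iterate_up_eq hG ω x v₀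
  rw [height_eq hG ω h, height_eq hG ω (m := m) (n := n + 1)]
  · push_cast
    ring
  · rw [← Function.iterate_succ_apply, Function.iterate_succ_apply', h,
      Function.iterate_succ_apply']

@[simp] theorem height_iterate_up (hG : G.IsTree) (ω : Ends G) (v₀ x : V) (k : ℕ) :
    height hG ω v₀ ((up hG ω)^[k] x) = height hG ω v₀ x + k := by
  induction k with
  | zero => simp
  | succ k ih =>
    rw [Function.iterate_succ_apply', height_up, ih]
    push_cast
    ring

theorem dist_iterate_up_le (hG : G.IsTree) (ω : Ends G) (x : V) (k : ℕ) :
    G.dist x ((up hG ω)^[k] x) ≤ k := by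
  induction k with
  | zero => simp
  | succ k ih =>
    rw [Function.iterate_succ_apply']
    have h1 := hG.connected.dist_triangle (u := x) (v := (up hG ω)^[k] x)
      (w := up hG ω ((up hG ω)^[k] x))
    have h2 := (SimpleGraph.dist_eq_one_iff_adj).2 (adj_up hG ω ((up hG ω)^[k] x))
    omega

theorem abs_height_sub_le_length (hG : G.IsTree) (ω : Ends G) (v₀ : V) {x y : V} (p : G.Walk x y) :
    |height hG ω v₀ x - height hG ω v₀ y| ≤ p.length := by
  induction p with
  | nil => simp
  | @cons a b c h p ih =>
    have : |height hG ω v₀ a - height hG ω v₀ b| ≤ 1 := by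
      rcases eq_up_or_up_eq hG ω h with rfl | rfl <;> simp
    rw [SimpleGraph.Walk.length_cons]
    push_cast
    have := abs_sub_le (height hG ω v₀ a) (height hG ω v₀ b) (height hG ω v₀ c)
    omega

theorem abs_height_sub_le_dist (hG : G.IsTree) (ω : Ends G) (v₀ x y : V) :
    |height hG ω v₀ x - height hG ω v₀ y| ≤ G.dist x y := by
  obtain ⟨p, hp⟩ := (hG.connected.preconnected x y).exists_walk_length_eq_dist
  rw [← hp]
  exact abs_height_sub_le_length hG ω v₀ p

/-- The height is 1-Lipschitz and rises by `k` along `k` parent steps, so these steps form a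
geodesic. -/
theorem dist_iterate_up (hG : G.IsTree) (ω : Ends G) (x : V) (k : ℕ) :
    G.dist x ((up hG ω)^[k] x) = k := by
  have h1 := abs_height_sub_le_dist hG ω x x ((up hG ω)^[k] x)
  have h2 := dist_iterate_up_le hG ω x k
  rw [height_iterate_up, abs_le] at h1
  omega

/-- The set of descendants of `x`: those vertices `y` such that `x` lies on the ray from `y`
to `ω`. -/
def descendants (hG : G.IsTree) (ω : Ends G) (x : V) : Set V :=
  {y | ∃ k, (up hG ω)^[k] y = x}

theorem mem_descendants_self (hG : G.IsTree) (ω : Ends G) (x : V) : x ∈ descendants hG ω x :=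
  ⟨0, rfl⟩

theorem descendants_subset (hG : G.IsTree) (ω : Ends G) (x : V) :
    descendants hG ω x ⊆ descendants hG ω (up hG ω x) := by
  rintro y ⟨k, rfl⟩
  exact ⟨k + 1, Function.iterate_succ_apply' _ _ _⟩

theorem height_le_of_mem_descendants (hG : G.IsTree) (ω : Ends G) (v₀ : V) {x y : V}
    (h : y ∈ descendants hG ω x) : height hG ω v₀ y ≤ height hG ω v₀ x := by
  obtain ⟨k, rfl⟩ := h
  simp

/-- A path enters the set of descendants of `u` only through `u`. -/
theorem eq_of_adj_of_mem_descendants (hG : G.IsTree) (ω : Ends G) {u x y : V} (hxy : G.Adj x y)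
    (hx : x ∉ descendants hG ω u) (hy : y ∈ descendants hG ω u) : y = u := by
  obtain ⟨k, hk⟩ := hy
  rcases eq_up_or_up_eq hG ω hxy with rfl | rfl
  · exact absurd ⟨k + 1, hk⟩ hx
  · cases k with
    | zero => exact hk
    | succ k => exact absurd ⟨k, hk⟩ hx

/-- In a tree, a vertex `y` has at most one neighbour closer to `x` than `y`. -/
theorem eq_of_dist_lt (hG : G.IsTree) {x y z z' : V} (hz : G.Adj y z) (hz' : G.Adj y z')
    (h : G.dist x z < G.dist x y) (h' : G.dist x z' < G.dist x y) : z = z' := by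
  classical
  have key : ∀ w, G.Adj y w → G.dist x w < G.dist x y → ∃ p : G.Walk y x, p.IsPath ∧
      p.getVert 1 = w := by
    intro w hw hlt
    obtain ⟨p, hp, hl⟩ := hG.connected.exists_path_of_dist w x
    refine ⟨SimpleGraph.Walk.cons hw p, ?_, by simp⟩
    rw [SimpleGraph.Walk.cons_isPath_iff]
    refine ⟨hp, fun hy => ?_⟩
    have h1 := SimpleGraph.dist_le (p.dropUntil y hy)
    have h2 := p.length_dropUntil_le_length hy
    rw [SimpleGraph.dist_comm] at h1
    rw [SimpleGraph.dist_comm (u := x) (v := w)] at hlt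
    omega
  obtain ⟨p, hp, rfl⟩ := key z hz h
  obtain ⟨p', hp', rfl⟩ := key z' hz' h'
  have := congrArg Subtype.val ((hG.isAcyclic.subsingleton_path y x).elim ⟨p, hp⟩ ⟨p', hp'⟩)
  simp only at this
  rw [this]

theorem dist_lt_up_of_mem_descendants (hG : G.IsTree) (ω : Ends G) {u x : V}
    (h : x ∈ descendants hG ω u) : G.dist x u < G.dist x (up hG ω u) := by
  obtain ⟨k, rfl⟩ := h
  rw [← Function.iterate_succ_apply' (up hG ω), dist_iterate_up, dist_iterate_up]
  omega

/-- Induction along a geodesic from `u` to `x`: its first step cannot go to the parent, which is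
farther from `x`, so it goes to a child, for which the hypothesis holds again with `d` lowered by
one. -/
theorem mem_descendants_of_dist_lt (hG : G.IsTree) (ω : Ends G) {x : V} (d : ℕ) : ∀ {u : V},
    G.dist x u = d → d < G.dist x (up hG ω u) → x ∈ descendants hG ω u := by
  induction d with
  | zero =>
    intro u h0 _
    obtain rfl := (hG.connected.dist_eq_zero_iff).1 h0
    exact mem_descendants_self hG ω _
  | succ d ih =>
    intro u hd hlt
    obtain ⟨p, hp⟩ := (hG.connected.preconnected u x).exists_walk_length_eq_dist
    rw [SimpleGraph.dist_comm, hd] at hp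
    cases p with
    | nil => simp at hp
    | @cons _ u' _ hu p =>
      rw [SimpleGraph.Walk.length_cons] at hp
      have h1 := SimpleGraph.dist_le p
      have h2 := SimpleGraph.dist_comm (G := G) (u := u') (v := x)
      rcases eq_up_or_up_eq hG ω hu with rfl | hu'
      · omega
      · rcases hG.dist_eq_dist_add_one_of_adj x hu with h3 | h3
        · have := ih (u := u') (by omega) (by rw [hu']; omega)
          rw [← hu']
          exact descendants_subset hG ω u' this
        · omega

/-- This expresses lying behind the edge from `up hG ω u` to `u` by distances alone, the form in
which convergence to an end is tested later. -/
theorem mem_descendants_iff (hG : G.IsTree) (ω : Ends G) {u x : V} :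
    x ∈ descendants hG ω u ↔ G.dist x u < G.dist x (up hG ω u) :=
  ⟨dist_lt_up_of_mem_descendants hG ω, fun h => mem_descendants_of_dist_lt hG ω _ rfl h⟩

theorem notMem_descendants_iff (hG : G.IsTree) (ω : Ends G) {u x : V} :
    x ∉ descendants hG ω u ↔ G.dist x (up hG ω u) < G.dist x u := by
  rw [mem_descendants_iff, not_lt]
  rcases hG.dist_eq_dist_add_one_of_adj x (adj_up hG ω u) with h | h <;> omega

theorem Ray.dist_eq (hG : G.IsTree) (ρ : Ray G) (k : ℕ) : G.dist (ρ 0) (ρ k) = k := by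
  obtain ⟨ω, h⟩ : ∃ ω, ρ.Represents ω := ⟨_, rfl⟩
  have := dist_iterate_up hG ω (ρ 0) k
  rwa [← h.apply_eq_iterate_up hG] at this

/-- Once the distance to `x` decreases along an edge of the ray, it has decreased along all earlier
edges: otherwise some vertex of the ray would have both its ray neighbours closer to `x`, against
`eq_of_dist_lt`. -/
theorem Ray.dist_add_of_lt (hG : G.IsTree) (ρ : Ray G) {x : V} {k : ℕ}
    (h : G.dist x (ρ (k + 1)) < G.dist x (ρ k)) : G.dist x (ρ k) + k = G.dist x (ρ 0) := by
  induction k with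
  | zero => simp
  | succ k ih =>
    have h1 : G.dist x (ρ (k + 1)) + 1 = G.dist x (ρ k) := by
      rcases hG.dist_eq_dist_add_one_of_adj x (ρ.adj k) with h2 | h2
      · exact h2.symm
      · have := eq_of_dist_lt hG (ρ.adj (k + 1)) (ρ.adj k).symm h (by omega)
        have := ρ.inj this
        omega
    have := ih (by omega)
    omega

/-- One ray of `ξ` suffices: any other shares a tail with it, and by `Ray.dist_add_of_lt` a decrease
of the distance far out puts the preceding vertex of that ray on the geodesic to `x i`. -/
theorem convergesTo_of_eventually_dist_lt (hG : G.IsTree) {x : ℕ → V} {ξ : Ends G} {σ : Ray G}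
    (hσ : σ.Represents ξ)
    (h : ∀ k, ∀ᶠ i in atTop, G.dist (x i) (σ (k + 1)) < G.dist (x i) (σ k)) :
    ConvergesTo x ξ := by
  intro ρ hρ
  obtain ⟨m, n, hmn⟩ : ρ ≈ σ := Quotient.exact (hρ.trans hσ.symm)
  rw [tendsto_atTop]
  intro K
  filter_upwards [h (n + K)] with i hi
  have h1 : G.dist (x i) (ρ (m + K + 1)) < G.dist (x i) (ρ (m + K)) := by
    rw [hmn K, Nat.add_assoc, hmn (K + 1)]
    exact hi
  have h2 := ρ.dist_add_of_lt hG h1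
  have h3 : OnGeodesic G (ρ 0) (x i) (ρ (m + K)) := by
    unfold OnGeodesic
    rw [ρ.dist_eq hG, SimpleGraph.dist_comm, SimpleGraph.dist_comm (u := ρ 0)]
    omega
  -- The set must be shown bounded, since `sSup` of an unbounded set of naturals is 0.
  refine le_trans (Nat.le_add_left K m) (le_csSup ⟨G.dist (ρ 0) (x i), ?_⟩ h3)
  intro k hk
  have : G.dist (ρ 0) (ρ k) + G.dist (ρ k) (x i) = G.dist (ρ 0) (x i) := hk
  rw [ρ.dist_eq hG] at this
  omega

/-- Two ends behind the same directed edges coincide. -/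
theorem Ends.ext_directed (hG : G.IsTree) (v₀ : V) {ξ η : Ends G}
    (h : ∀ x y, Directed ξ x y → Directed η x y) : ξ = η := by
  obtain ⟨ρ, hρ, h0⟩ := exists_ray hG ξ v₀
  obtain ⟨σ, hσ, h0'⟩ := exists_ray hG η v₀
  rw [← hρ, ← hσ]
  refine Quotient.sound ⟨0, 0, fun k => ?_⟩
  simp only [Nat.zero_add]
  induction k with
  | zero => rw [h0, h0']
  | succ k ih =>
    have := h _ _ (hρ.directed k)
    rw [ih] at this
    exact (existsUnique_directed hG η _).unique this (hσ.directed k)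

end TreeGeometry

/-! ### One step of the chain. -/

section OneStep

variable {V : Type u} {G : SimpleGraph V} {q : ℕ}

theorem mem_levelSet_succ_of_adj {v₀ x y : V} {n : ℕ} (hx : x ∈ levelSet G v₀ n)
    (hxy : G.Adj x y) : y ∈ levelSet G v₀ (n + 1) := by
  obtain ⟨p, hp⟩ := hx
  exact ⟨p.concat hxy, by simp [hp]⟩

theorem transProb_up (hG : G.IsTree) (ω : Ends G) (r : ℝ) (x : V) :
    transProb q ω r x (up hG ω x) = ENNReal.ofReal r := by
  simp [transProb, adj_up, directed_up]

theorem transProb_child (hG : G.IsTree) (ω : Ends G) (r : ℝ) {x y : V} (h : up hG ω y = x) :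
    transProb q ω r x y = ENNReal.ofReal ((1 - r) / q) := by
  subst h
  have : ¬ Directed ω (up hG ω y) y := fun h =>
    up_up_ne hG ω y ((directed_iff_eq_up hG).1 h).symm
  simp [transProb, (adj_up hG ω y).symm, this]

theorem transProb_of_not_adj (ω : Ends G) (r : ℝ) {x y : V} (h : ¬ G.Adj x y) :
    transProb q ω r x y = 0 := if_neg h

variable [G.LocallyFinite]

theorem finite_levelSet (G : SimpleGraph V) [G.LocallyFinite] (v₀ : V) (n : ℕ) :
    (levelSet G v₀ n).Finite := by
  induction n with
  | zero =>
    refine (Set.finite_singleton v₀).subset ?_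
    rintro v ⟨p, hp⟩
    exact (SimpleGraph.Walk.eq_of_length_eq_zero hp).symm
  | succ n ih =>
    refine (ih.biUnion fun x _ => (G.neighborFinset x).finite_toSet).subset ?_
    rintro v ⟨p, hp⟩
    have hnil : ¬ p.Nil := fun h => by
      have := SimpleGraph.Walk.length_eq_zero_iff.2 h
      omega
    refine Set.mem_biUnion (x := p.penultimate) ⟨p.dropLast, by simp [hp]⟩ ?_
    simpa using p.adj_penultimate hnil

instance (v₀ : V) (n : ℕ) : Finite (Level G v₀ n) := (finite_levelSet G v₀ n).to_subtype

theorem countable_vertices (hG : G.IsTree) : Countable V := by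
  obtain ⟨v₀⟩ := hG.connected.nonempty
  have : (⋃ n, levelSet G v₀ n) = Set.univ := by
    refine Set.eq_univ_of_forall fun v => ?_
    obtain ⟨p⟩ := hG.connected.preconnected v₀ v
    exact Set.mem_iUnion.2 ⟨p.length, p, rfl⟩
  rw [← Set.countable_univ_iff, ← this]
  exact Set.countable_iUnion fun n => (finite_levelSet G v₀ n).countable

open Classical in
/-- The neighbours of `x` that are farther than `x` from `ω`. -/
noncomputable def children (hG : G.IsTree) (ω : Ends G) (x : V) : Finset V :=
  (G.neighborFinset x).erase (up hG ω x)

theorem mem_children (hG : G.IsTree) {ω : Ends G} {x y : V} :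
    y ∈ children hG ω x ↔ up hG ω y = x := by
  classical
  unfold children
  rw [Finset.mem_erase, SimpleGraph.mem_neighborFinset]
  constructor
  · rintro ⟨h1, h2⟩
    exact (eq_up_or_up_eq hG ω h2).resolve_left h1
  · rintro rfl
    exact ⟨(up_up_ne hG ω y).symm, (adj_up hG ω y).symm⟩

theorem up_of_mem_children {hG : G.IsTree} {ω : Ends G} {x y : V} (h : y ∈ children hG ω x) :
    up hG ω y = x := (mem_children hG).1 h

theorem card_children (hG : IsHomogeneousTree G q) (ω : Ends G) (x : V) :
    (children hG.isTree ω x).card = q := by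
  classical
  unfold children
  rw [Finset.card_erase_of_mem (by simpa using adj_up hG.isTree ω x),
    SimpleGraph.card_neighborFinset_eq_degree, hG.regular x, Nat.add_sub_cancel]

theorem sum_neighborFinset (hG : G.IsTree) (ω : Ends G) {M : Type*} [AddCommMonoid M] (f : V → M)
    (x : V) : ∑ y ∈ G.neighborFinset x, f y = f (up hG ω x) + ∑ y ∈ children hG ω x, f y := by
  classical
  unfold children
  rw [Finset.add_sum_erase _ _ (by simpa using adj_up hG ω x)]

/-- The mean of `f` after one step of the chain from `x`. -/
noncomputable def transMean (hG : G.IsTree) (q : ℕ) (ω : Ends G) (r : ℝ) (f : V → ℝ) (x : V) : ℝ :=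
  r * f (up hG ω x) + (1 - r) / q * ∑ y ∈ children hG ω x, f y

theorem transMean_eq_sum (hG : G.IsTree) (q : ℕ) (ω : Ends G) (r : unitInterval) (f : V → ℝ)
    (x : V) : transMean hG q ω r f x =
      ∑ y ∈ G.neighborFinset x, (transProb q ω r x y).toReal * f y := by
  rw [sum_neighborFinset hG ω, transProb_up, ENNReal.toReal_ofReal r.2.1, transMean,
    Finset.mul_sum]
  congr 1
  refine Finset.sum_congr rfl fun y hy => ?_
  rw [transProb_child hG ω r (up_of_mem_children hy), ENNReal.toReal_ofReal]
  exact div_nonneg (by linarith [r.2.2]) (by positivity)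

theorem transMean_indicator (hG : G.IsTree) (q : ℕ) (ω : Ends G) (r : unitInterval) (x y : V) :
    transMean hG q ω r (Set.indicator {y} 1) x = (transProb q ω r x y).toReal := by
  classical
  rw [transMean_eq_sum]
  by_cases hxy : G.Adj x y
  · rw [Finset.sum_eq_single y]
    · simp
    · intro b _ hb
      simp [hb]
    · intro h
      exact absurd (by simpa using hxy) h
  · rw [transProb_of_not_adj ω r hxy, ENNReal.toReal_zero]
    refine Finset.sum_eq_zero fun z hz => ?_
    have : z ≠ y := by
      rintro rfl
      exact hxy (by simpa using hz)
    simp [this]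

theorem integral_step (hG : IsHomogeneousTree G q) (hq : 2 ≤ q) (v₀ : V) (ω : Ends G)
    (r : unitInterval) (n : ℕ) (v : Level G v₀ n) (f : V → ℝ) :
    ∫ y, f y.1 ∂(step hG hq v₀ ω r n v).toMeasure = transMean hG.isTree q ω r f v.1 := by
  have hs : (fun y => (transProb q ω r v.1 y).toReal * f y).support ⊆ G.neighborFinset v.1 := by
    intro y hy
    rw [SimpleGraph.coe_neighborFinset, SimpleGraph.mem_neighborSet]
    by_contra hne
    exact hy (by simp [transProb_of_not_adj ω r hne])
  rw [PMF.integral_eq_tsum _ _ Integrable.of_finite, transMean_eq_sum]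
  simp only [smul_eq_mul]
  change ∑' y : Level G v₀ (n + 1), (transProb q ω r v.1 y.1).toReal * f y.1 = _
  rw [tsum_subtype_eq_of_support_subset (f := fun y => (transProb q ω r v.1 y).toReal * f y)
      (s := levelSet G v₀ (n + 1)) fun y hy => mem_levelSet_succ_of_adj v.2
        (by simpa using hs hy),
    tsum_eq_sum (s := G.neighborFinset v.1) fun y hy => by
      by_contra h
      exact hy (hs h)]

end OneStep

/-! ### The Markov property and the probabilities of finite paths. -/

section Chain

variable {V : Type u} {G : SimpleGraph V} [G.LocallyFinite] {q : ℕ}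
  (hG : IsHomogeneousTree G q) (hq : 2 ≤ q) (v₀ : V) (ω : Ends G) (r : unitInterval)

instance : IsProbabilityMeasure (chainLaw hG hq v₀ ω r) := by
  unfold chainLaw
  infer_instance

variable {v₀} in
theorem integrable_level (μ : Measure (∀ n, Level G v₀ n)) [IsFiniteMeasure μ] (n : ℕ)
    (f : V → ℝ) : Integrable (fun z => f (z n).1) μ := by
  have h : Integrable (fun v : Level G v₀ n => f v.1) (μ.map fun z => z n) := Integrable.of_finite
  exact h.comp_measurable (measurable_pi_apply n)

/-- The Markov property: given the path up to time `n`, the mean of a function of the next vertex is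
its one-step mean from the present vertex. -/
theorem setIntegral_chainLaw_succ (f : V → ℝ) (n : ℕ) {s : Set (∀ n, Level G v₀ n)}
    (hs : MeasurableSet[Filtration.piLE n] s) :
    ∫ z in s, f (z (n + 1)).1 ∂(chainLaw hG hq v₀ ω r) =
      ∫ z in s, transMean hG.isTree q ω r f (z n).1 ∂(chainLaw hG hq v₀ ω r) := by
  rw [Filtration.piLE_eq_comap_frestrictLe] at hs
  obtain ⟨t, ht, rfl⟩ := hs
  set P := chainLaw hG hq v₀ ω r with hP
  have hm : Measurable (fun z : ∀ n, Level G v₀ n => (Preorder.frestrictLe n z, z (n + 1))) := by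
    fun_prop
  have key : P.map (Preorder.frestrictLe n) ⊗ₘ stepKernel hG hq v₀ ω r n =
      P.map (fun x => (Preorder.frestrictLe n x, x (n + 1))) :=
    Kernel.map_frestrictLe_trajMeasure_compProd_eq_map_trajMeasure
  have hF : Measurable fun p : ((i : Finset.Iic n) → Level G v₀ i) × Level G v₀ (n + 1) =>
      f p.2.1 := (Measurable.of_discrete (f := fun v : Level G v₀ (n + 1) => f v.1)).comp
        measurable_snd
  have hF' : Measurable fun p : ((i : Finset.Iic n) → Level G v₀ i) =>
      transMean hG.isTree q ω r f (p ⟨n, Finset.mem_Iic.2 le_rfl⟩).1 :=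
    (Measurable.of_discrete (f := fun v : Level G v₀ n =>
      transMean hG.isTree q ω r f v.1)).comp (measurable_pi_apply _)
  have h1 : ∫ z in Preorder.frestrictLe n ⁻¹' t, f (z (n + 1)).1 ∂P =
      ∫ p in t ×ˢ Set.univ, f p.2.1 ∂(P.map (Preorder.frestrictLe n) ⊗ₘ
        stepKernel hG hq v₀ ω r n) := by
    rw [key, setIntegral_map (ht.prod MeasurableSet.univ) hF.aestronglyMeasurable hm.aemeasurable]
    congr 2
    ext z
    simp
  rw [h1, Measure.setIntegral_compProd ht MeasurableSet.univ, setIntegral_map ht _ (by fun_prop)]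
  · refine setIntegral_congr_fun (ht.preimage (by fun_prop)) fun z _ => ?_
    simp only [Measure.restrict_univ]
    exact integral_step hG hq v₀ ω r n (z n) f
  · simp only [Measure.restrict_univ]
    refine (hF'.aestronglyMeasurable).congr (Eventually.of_forall fun p => ?_)
    exact (integral_step hG hq v₀ ω r n _ f).symm
  · refine Integrable.integrableOn ?_
    rw [key, integrable_map_measure hF.aestronglyMeasurable hm.aemeasurable]
    exact integrable_level P (n + 1) f

omit [G.LocallyFinite] in
theorem stronglyAdapted_level (f : V → ℝ) :
    StronglyAdapted (Filtration.piLE (X := fun n => Level G v₀ n)) fun n z => f (z n).1 := by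
  intro n
  refine Measurable.stronglyMeasurable ?_
  refine (Measurable.of_discrete (f := fun v : Level G v₀ n => f v.1)).comp ?_
  rw [Filtration.piLE_eq_comap_frestrictLe]
  exact (measurable_pi_apply (X := fun i : Finset.Iic n => Level G v₀ i)
    ⟨n, Finset.mem_Iic.2 le_rfl⟩).comp (comap_measurable _)

/-- The Markov property reduces this to a one-step inequality; integrability costs nothing, since
each level is finite. -/
theorem supermartingale_of_transMean_le {f : V → ℝ}
    (hf : ∀ x, transMean hG.isTree q ω r f x ≤ f x) :
    Supermartingale (fun n (z : ∀ n, Level G v₀ n) => f (z n).1) Filtration.piLE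
      (chainLaw hG hq v₀ ω r) := by
  refine supermartingale_of_setIntegral_succ_le (stronglyAdapted_level v₀ f)
    (fun n => integrable_level _ n f) fun n s hs => ?_
  rw [setIntegral_chainLaw_succ hG hq v₀ ω r f n hs]
  exact setIntegral_mono (integrable_level _ n _).integrableOn
    (integrable_level _ n f).integrableOn fun z => hf _

omit [G.LocallyFinite] in
theorem Level.eq_base {v₀ : V} (v : Level G v₀ 0) : v.1 = v₀ := by
  obtain ⟨p, hp⟩ := v.2
  exact (SimpleGraph.Walk.eq_of_length_eq_zero hp).symm

omit [G.LocallyFinite] in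
theorem measurableSet_level (n : ℕ) (s : Set V) :
    MeasurableSet[Filtration.piLE n] {z : ∀ n, Level G v₀ n | (z n).1 ∈ s} := by
  rw [Filtration.piLE_eq_comap_frestrictLe]
  refine ⟨{p | (p ⟨n, Finset.mem_Iic.2 le_rfl⟩).1 ∈ s}, ?_, rfl⟩
  exact (MeasurableSet.of_discrete (s := {v : Level G v₀ n | v.1 ∈ s})).preimage
    (measurable_pi_apply (X := fun i : Finset.Iic n => Level G v₀ i) ⟨n, Finset.mem_Iic.2 le_rfl⟩)

/-- The probability of a step from `x` to `y` after an event in the past. -/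
theorem measureReal_inter_succ {n : ℕ} {s : Set (∀ n, Level G v₀ n)}
    (hs : MeasurableSet[Filtration.piLE n] s) {x : V} (hx : ∀ z ∈ s, (z n).1 = x) (y : V) :
    (chainLaw hG hq v₀ ω r).real (s ∩ {z | (z (n + 1)).1 = y}) =
      (chainLaw hG hq v₀ ω r).real s * (transProb q ω r x y).toReal := by
  have h := setIntegral_chainLaw_succ hG hq v₀ ω r (Set.indicator {y} 1) n hs
  have hs' := Filtration.piLE.le n _ hs
  have h1 : ∫ z in s, transMean hG.isTree q ω r (Set.indicator {y} 1) (z n).1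
      ∂(chainLaw hG hq v₀ ω r) = ∫ _ in s, (transProb q ω r x y).toReal
        ∂(chainLaw hG hq v₀ ω r) :=
    setIntegral_congr_fun hs' fun z hz => by simp only [hx z hz, transMean_indicator]
  rw [h1, setIntegral_const, smul_eq_mul] at h
  rw [← h]
  have hm : MeasurableSet {z : ∀ n, Level G v₀ n | (z (n + 1)).1 = y} :=
    Filtration.piLE.le _ _ (measurableSet_level v₀ (n + 1) {y})
  have : (fun z : ∀ n, Level G v₀ n => Set.indicator {y} (1 : V → ℝ) (z (n + 1)).1) =
      Set.indicator {z : ∀ n, Level G v₀ n | (z (n + 1)).1 = y} 1 := rfl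
  rw [this, integral_indicator_one hm, measureReal_restrict_apply hm, Set.inter_comm]

/-- For each time there are only countably many pairs of nonadjacent vertices, and each is a step of
probability zero. -/
theorem ae_adj : ∀ᵐ z ∂(chainLaw hG hq v₀ ω r), ∀ n, G.Adj (z n).1 (z (n + 1)).1 := by
  have := countable_vertices hG.isTree
  rw [ae_all_iff]
  intro n
  have h : ∀ x y : V, ¬ G.Adj x y → ∀ᵐ z ∂(chainLaw hG hq v₀ ω r),
      ¬ ((z n).1 = x ∧ (z (n + 1)).1 = y) := by
    intro x y hxy
    have := measureReal_inter_succ hG hq v₀ ω r (measurableSet_level v₀ n {x}) (fun z hz => hz) y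
    rw [transProb_of_not_adj ω r hxy, ENNReal.toReal_zero, mul_zero,
      measureReal_eq_zero_iff] at this
    rw [ae_iff]
    simpa [Set.inter_def] using this
  have h' : ∀ᵐ z ∂(chainLaw hG hq v₀ ω r), ∀ x y : V, ¬ G.Adj x y →
      ¬ ((z n).1 = x ∧ (z (n + 1)).1 = y) := by
    rw [ae_all_iff]
    intro x
    rw [ae_all_iff]
    intro y
    by_cases hxy : G.Adj x y
    · exact Eventually.of_forall fun z h => absurd hxy h
    · filter_upwards [h x y hxy] with z hz _ using hz
  filter_upwards [h'] with z hz
  by_contra hne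
  exact hz _ _ hne ⟨rfl, rfl⟩

/-- The probability that the chain starts with a given finite sequence. -/
theorem measureReal_cylinder (z : ∀ n, Level G v₀ n) (n : ℕ) :
    (chainLaw hG hq v₀ ω r).real {z' | ∀ k ≤ n, z' k = z k} =
      ∏ k ∈ Finset.range n, (transProb q ω r (z k).1 (z (k + 1)).1).toReal := by
  induction n with
  | zero =>
    have : {z' : ∀ n, Level G v₀ n | ∀ k ≤ 0, z' k = z k} = Set.univ := by
      refine Set.eq_univ_of_forall fun z' k hk => ?_
      obtain rfl : k = 0 := by omega
      exact Subtype.ext ((z' 0).eq_base.trans (z 0).eq_base.symm)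
    rw [this]
    simp
  | succ n ih =>
    rw [Finset.prod_range_succ, ← ih, ← measureReal_inter_succ hG hq v₀ ω r (n := n)]
    · congr 1
      ext z'
      simp only [Set.mem_ofPred_eq, Set.mem_inter_iff, Nat.le_succ_iff_eq_or_le, Subtype.ext_iff]
      constructor
      · exact fun h => ⟨fun k hk => h k (Or.inr hk), h _ (Or.inl rfl)⟩
      · rintro ⟨h1, h2⟩ k (rfl | hk)
        exacts [h2, h1 k hk]
    · have : {z' : ∀ n, Level G v₀ n | ∀ k ≤ n, z' k = z k} =
          ⋂ k ∈ Set.Iic n, {z' | (z' k).1 ∈ ({(z k).1} : Set V)} := by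
        ext z'
        simp [Subtype.ext_iff]
      rw [this]
      exact MeasurableSet.biInter (Set.to_countable _) fun k hk =>
        Filtration.piLE.mono hk _ (measurableSet_level v₀ k _)
    · exact fun z' hz' => congrArg Subtype.val (hz' n le_rfl)

theorem measurableSet_pathSet : MeasurableSet (pathSet G v₀) := by
  have : pathSet G v₀ = ⋂ n, {z | G.Adj (z n).1 (z (n + 1)).1} := by
    ext z
    simp [pathSet]
  rw [this]
  refine MeasurableSet.iInter fun n => ?_
  exact (MeasurableSet.of_discrete (s := {p : Level G v₀ n × Level G v₀ (n + 1) |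
    G.Adj p.1.1 p.2.1})).preimage (f := fun z : ∀ n, Level G v₀ n => (z n, z (n + 1)))
    (by fun_prop)

/-- A comap forgets the mass outside the path set; by `ae_adj` there is none. -/
theorem map_markovMeasure :
    (markovMeasure hG hq v₀ ω r).map Subtype.val = chainLaw hG hq v₀ ω r := by
  unfold markovMeasure
  rw [(MeasurableEmbedding.subtype_coe (measurableSet_pathSet v₀)).map_comap, Subtype.range_coe]
  exact Measure.restrict_eq_self_of_ae_mem (ae_adj hG hq v₀ ω r)

instance : IsProbabilityMeasure (markovMeasure hG hq v₀ ω r) := by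
  constructor
  have := congrArg (fun μ => μ Set.univ) (map_markovMeasure hG hq v₀ ω r)
  simpa [Measure.map_apply measurable_subtype_coe MeasurableSet.univ] using this

theorem ae_markovMeasure {p : (∀ n, Level G v₀ n) → Prop}
    (h : ∀ᵐ z ∂(chainLaw hG hq v₀ ω r), p z) : ∀ᵐ w ∂(markovMeasure hG hq v₀ ω r), p w.1 := by
  rw [← map_markovMeasure] at h
  exact ae_of_ae_map measurable_subtype_coe.aemeasurable h

theorem measureReal_pathCylinder (w : Paths G v₀) (n : ℕ) :
    (markovMeasure hG hq v₀ ω r).real (pathCylinder w n) =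
      ∏ k ∈ Finset.range n, (transProb q ω r (proj w k) (proj w (k + 1))).toReal := by
  have := measureReal_cylinder hG hq v₀ ω r w.1 n
  rw [← map_markovMeasure, map_measureReal_apply measurable_subtype_coe] at this
  · exact this
  · have : {z' : ∀ n, Level G v₀ n | ∀ k ≤ n, z' k = w.1 k} =
        ⋂ k ∈ Set.Iic n, {z' | (z' k).1 ∈ ({(w.1 k).1} : Set V)} := by
      ext z'
      simp [Subtype.ext_iff]
    rw [this]
    exact MeasurableSet.biInter (Set.to_countable _) fun k hk =>
      Filtration.piLE.le _ _ (measurableSet_level v₀ k _)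

end Chain

/-! ### The law of large numbers for events; convergence of nonnegative supermartingales. -/

section Probability

variable {Ω : Type*} {m : MeasurableSpace Ω} {μ : Measure Ω}

theorem indepFun_indicator_one {A B : Set Ω} (h : IndepSet A B μ) :
    IndepFun (A.indicator (1 : Ω → ℝ)) (B.indicator (1 : Ω → ℝ)) μ := by
  have key : ∀ A : Set Ω, MeasurableSpace.comap (A.indicator (1 : Ω → ℝ)) inferInstance ≤
      MeasurableSpace.generateFrom {A} := by
    intro A
    have hA : MeasurableSet[MeasurableSpace.generateFrom {A}] A :=
      MeasurableSpace.measurableSet_generateFrom rfl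
    exact (Measurable.indicator (m := MeasurableSpace.generateFrom {A})
      (measurable_const (a := (1 : ℝ))) hA).comap_le
  rw [IndepFun_iff_Indep]
  exact indep_of_indep_of_le_left (indep_of_indep_of_le_right h (key B)) (key A)

theorem identDistrib_indicator_one [IsProbabilityMeasure μ] {A B : Set Ω} (hA : MeasurableSet A)
    (hB : MeasurableSet B) (h : μ A = μ B) :
    IdentDistrib (A.indicator (1 : Ω → ℝ)) (B.indicator (1 : Ω → ℝ)) μ μ := by
  classical
  have mA : Measurable (A.indicator (1 : Ω → ℝ)) := measurable_const.indicator hA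
  have mB : Measurable (B.indicator (1 : Ω → ℝ)) := measurable_const.indicator hB
  refine ⟨mA.aemeasurable, mB.aemeasurable, Measure.ext fun s hs => ?_⟩
  rw [Measure.map_apply mA hs, Measure.map_apply mB hs]
  have key : ∀ A : Set Ω, A.indicator (1 : Ω → ℝ) ⁻¹' s =
      (if (1 : ℝ) ∈ s then A else ∅) ∪ if (0 : ℝ) ∈ s then Aᶜ else ∅ :=
    fun A => Set.indicator_const_preimage_eq_union A s (1 : ℝ)
  have hc : μ Aᶜ = μ Bᶜ := by
    rw [prob_compl_eq_one_sub hA, prob_compl_eq_one_sub hB, h]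
  rw [key, key]
  split_ifs <;> simp [h, hc]

/-- The strong law of large numbers for pairwise independent events of the same probability. -/
theorem strong_law_indicator [IsProbabilityMeasure μ] {A : ℕ → Set Ω}
    (hA : ∀ n, MeasurableSet (A n)) {p : ℝ} (hp : ∀ n, μ.real (A n) = p)
    (hind : ∀ i j, i < j → μ.real (A i ∩ A j) = p * p) :
    ∀ᵐ z ∂μ, Tendsto (fun n : ℕ => (∑ i ∈ Finset.range n, (A i).indicator (1 : Ω → ℝ) z) / n)
      atTop (𝓝 p) := by
  have hsets : ∀ i j, i < j → IndepSet (A i) (A j) μ := by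
    intro i j hij
    rw [indepSet_iff_measure_inter_eq_mul (hA i) (hA j) μ, ← ENNReal.toReal_eq_toReal_iff'
      (measure_ne_top _ _) (ENNReal.mul_ne_top (measure_ne_top _ _) (measure_ne_top _ _)),
      ENNReal.toReal_mul]
    change μ.real _ = μ.real _ * μ.real _
    rw [hind i j hij, hp, hp]
  have h := strong_law_ae_real (μ := μ) (fun n => (A n).indicator (1 : Ω → ℝ))
    ((integrable_const (1 : ℝ)).indicator (hA 0)) ?_ ?_
  · rw [integral_indicator_one (hA 0), hp] at h
    exact h
  · intro i j hij
    rcases lt_or_gt_of_ne hij with h | h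
    · exact indepFun_indicator_one (hsets i j h)
    · exact (indepFun_indicator_one (hsets j i h)).symm
  · intro i
    refine identDistrib_indicator_one (hA i) (hA 0) ?_
    rw [← ENNReal.toReal_eq_toReal_iff' (measure_ne_top _ _) (measure_ne_top _ _)]
    exact (hp i).trans (hp 0).symm

/-- A nonnegative supermartingale converges almost surely. -/
theorem Supermartingale.ae_exists_tendsto_of_nonneg [IsFiniteMeasure μ] {ℱ : Filtration ℕ m}
    {f : ℕ → Ω → ℝ} (hf : Supermartingale f ℱ μ) (h0 : ∀ n z, 0 ≤ f n z) :
    ∀ᵐ z ∂μ, ∃ c, Tendsto (fun n => f n z) atTop (𝓝 c) := by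
  -- Because `f` is nonnegative, the L¹ norms of the submartingale `-f` are the means of `f`, which
  -- never exceed the initial mean.
  have h := hf.neg.exists_ae_tendsto_of_bdd (R := (∫ z, f 0 z ∂μ).toNNReal) fun n => by
    have h1 : ∫ z, f n z ∂μ ≤ ∫ z, f 0 z ∂μ := by
      simpa using hf.setIntegral_le (Nat.zero_le n) MeasurableSet.univ
    rw [Pi.neg_apply, eLpNorm_neg, eLpNorm_one_eq_lintegral_enorm,
      ← ofReal_integral_norm_eq_lintegral_enorm (hf.integrable n)]
    simp only [Real.norm_eq_abs, abs_of_nonneg (h0 n _)]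
    exact ENNReal.ofReal_le_ofReal h1
  filter_upwards [h] with z ⟨c, hc⟩
  exact ⟨-c, by simpa using hc.neg⟩

end Probability

/-! ### The height as a random walk with drift 2r - 1. -/

section Drift

variable {V : Type u} {G : SimpleGraph V} [G.LocallyFinite] {q : ℕ}
  (hG : IsHomogeneousTree G q) (hq : 2 ≤ q) (v₀ : V) (ω : Ends G) (r : unitInterval)

include hq in
theorem transMean_height (x : V) : transMean hG.isTree q ω r
    (fun x => (height hG.isTree ω v₀ x : ℝ)) x = height hG.isTree ω v₀ x + (2 * r - 1) := by
  have h : ∀ y ∈ children hG.isTree ω x, (height hG.isTree ω v₀ y : ℝ) =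
      height hG.isTree ω v₀ x - 1 := by
    intro y hy
    rw [← up_of_mem_children hy, height_up]
    push_cast
    ring
  rw [transMean, Finset.sum_congr rfl h, Finset.sum_const, card_children hG, height_up]
  have : (q : ℝ) ≠ 0 := by positivity
  push_cast
  rw [nsmul_eq_mul]
  field_simp
  ring

/-- The event that the step at time `n` is directed towards `ω`. -/
def upEvent (n : ℕ) : Set (∀ n, Level G v₀ n) :=
  {z | height hG.isTree ω v₀ (z (n + 1)).1 = height hG.isTree ω v₀ (z n).1 + 1}

theorem measurableSet_upEvent (n : ℕ) :
    MeasurableSet[Filtration.piLE (n + 1)] (upEvent hG v₀ ω n) := by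
  have : upEvent hG v₀ ω n = ⋃ k : ℤ,
      {z | (z n).1 ∈ {x | height hG.isTree ω v₀ x = k}} ∩
        {z | (z (n + 1)).1 ∈ {x | height hG.isTree ω v₀ x = k + 1}} := by
    ext z
    simp [upEvent]
  rw [this]
  exact MeasurableSet.iUnion fun k => (Filtration.piLE.mono (Nat.le_succ n) _
    (measurableSet_level v₀ n _)).inter (measurableSet_level v₀ (n + 1) _)

theorem ae_height_succ : ∀ᵐ z ∂(chainLaw hG hq v₀ ω r), ∀ n,
    (height hG.isTree ω v₀ (z (n + 1)).1 : ℝ) =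
      height hG.isTree ω v₀ (z n).1 + (2 * (upEvent hG v₀ ω n).indicator 1 z - 1) := by
  filter_upwards [ae_adj hG hq v₀ ω r] with z hz n
  by_cases h : z ∈ upEvent hG v₀ ω n
  · rw [Set.indicator_of_mem h, Pi.one_apply]
    have : height hG.isTree ω v₀ (z (n + 1)).1 = height hG.isTree ω v₀ (z n).1 + 1 := h
    rw [this]
    push_cast
    ring
  · rw [Set.indicator_of_notMem h]
    rcases eq_up_or_up_eq hG.isTree ω (hz n) with h1 | h1
    · exact absurd (by simp [upEvent, h1]) h
    · rw [← h1, height_up]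
      push_cast
      ring

/-- The increment of the height is almost surely twice the indicator of the up-event minus 1, and
its conditional mean is 2r - 1. Taking an earlier up-event for `s` yields pairwise independence. -/
theorem measureReal_inter_upEvent {n : ℕ} {s : Set (∀ n, Level G v₀ n)}
    (hs : MeasurableSet[Filtration.piLE n] s) :
    (chainLaw hG hq v₀ ω r).real (s ∩ upEvent hG v₀ ω n) = (chainLaw hG hq v₀ ω r).real s * r := by
  set P := chainLaw hG hq v₀ ω r with hP
  have h := setIntegral_chainLaw_succ hG hq v₀ ω r (fun x => (height hG.isTree ω v₀ x : ℝ)) n hs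
  simp only [transMean_height hG hq] at h
  have hm := Filtration.piLE.le _ _ (measurableSet_upEvent hG v₀ ω n)
  have hi : Integrable ((upEvent hG v₀ ω n).indicator (1 : (∀ n, Level G v₀ n) → ℝ)) P :=
    (integrable_const (1 : ℝ)).indicator hm
  have hh : IntegrableOn (fun z => (height hG.isTree ω v₀ (z n).1 : ℝ)) s P :=
    (integrable_level P n (fun x => (height hG.isTree ω v₀ x : ℝ))).integrableOn
  have hu : Integrable (fun z => 2 * (upEvent hG v₀ ω n).indicator
      (1 : (∀ n, Level G v₀ n) → ℝ) z - 1) (P.restrict s) :=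
    ((hi.const_mul 2).sub (integrable_const 1)).integrableOn
  rw [setIntegral_congr_ae (Filtration.piLE.le n _ hs)
    ((ae_height_succ hG hq v₀ ω r).mono fun z hz _ => hz n),
    integral_add hh hu, integral_add hh (integrable_const _), add_right_inj,
    integral_sub (hi.const_mul 2).integrableOn (integrable_const 1),
    integral_const_mul, integral_indicator_one hm, measureReal_restrict_apply hm,
    setIntegral_const, setIntegral_const, Set.inter_comm] at h
  simp only [smul_eq_mul] at h
  linarith

theorem ae_tendsto_height_div : ∀ᵐ z ∂(chainLaw hG hq v₀ ω r),
    Tendsto (fun n : ℕ => (height hG.isTree ω v₀ (z n).1 : ℝ) / n) atTop (𝓝 (2 * r - 1)) := by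
  have hm := fun n => Filtration.piLE.le _ _ (measurableSet_upEvent hG v₀ ω n)
  have hp : ∀ n, (chainLaw hG hq v₀ ω r).real (upEvent hG v₀ ω n) = r := fun n => by
    have := measureReal_inter_upEvent hG hq v₀ ω r (n := n) MeasurableSet.univ
    simpa using this
  have h := strong_law_indicator hm hp fun i j hij => by
    rw [measureReal_inter_upEvent hG hq v₀ ω r
      (Filtration.piLE.mono hij _ (measurableSet_upEvent hG v₀ ω i)), hp]
  filter_upwards [h, ae_height_succ hG hq v₀ ω r] with z h1 h2
  have h3 : ∀ n : ℕ, (height hG.isTree ω v₀ (z n).1 : ℝ) =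
      2 * (∑ i ∈ Finset.range n, (upEvent hG v₀ ω i).indicator (1 : (∀ n, Level G v₀ n) → ℝ) z) - n := by
    intro n
    induction n with
    | zero => simp [(z 0).eq_base]
    | succ n ih =>
      rw [h2 n, ih, Finset.sum_range_succ]
      push_cast
      ring
  refine ((h1.const_mul 2).sub_const 1).congr' ?_
  filter_upwards [eventually_gt_atTop 0] with n hn
  rw [h3 n]
  field_simp

/-- If the drift is nonnegative, then the heights are almost surely unbounded. -/
theorem ae_exists_height_ge (hr : (1 / 2 : ℝ) ≤ r) : ∀ᵐ z ∂(chainLaw hG hq v₀ ω r),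
    ∀ K : ℤ, ∃ n, K ≤ height hG.isTree ω v₀ (z n).1 := by
  have hsup : Supermartingale (fun n (z : ∀ n, Level G v₀ n) =>
      -(height hG.isTree ω v₀ (z n).1 : ℝ)) Filtration.piLE (chainLaw hG hq v₀ ω r) :=
    supermartingale_of_transMean_le hG hq v₀ ω r
      (f := fun x => -(height hG.isTree ω v₀ x : ℝ)) fun x => by
        have := transMean_height hG hq v₀ ω r x
        simp only [transMean, Finset.sum_neg_distrib] at this ⊢
        linarith
  -- A submartingale with bounded increments converges almost surely wherever it is bounded above.
  -- The height has increments ±1 and cannot converge, so it is unbounded above.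
  have h := hsup.neg.bddAbove_iff_exists_tendsto (R := 1) (by
    filter_upwards [ae_height_succ hG hq v₀ ω r] with z hz n
    simp only [Pi.neg_apply, neg_neg, hz n, NNReal.coe_one]
    by_cases h : z ∈ upEvent hG v₀ ω n
    · norm_num [h]
    · norm_num [h])
  filter_upwards [h, ae_height_succ hG hq v₀ ω r] with z h1 h2
  by_contra! hK
  obtain ⟨K, hK⟩ := hK
  obtain ⟨c, hc⟩ := h1.1 ⟨K, by
    rintro _ ⟨n, rfl⟩
    simp only [Pi.neg_apply, neg_neg]
    exact_mod_cast (hK n).le⟩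
  simp only [Pi.neg_apply, neg_neg] at hc
  have h3 := ((hc.comp (tendsto_add_atTop_nat 1)).sub hc).abs
  rw [sub_self, abs_zero] at h3
  obtain ⟨n, hn⟩ := (h3.eventually (gt_mem_nhds one_pos)).exists
  simp only [Function.comp_apply, h2 n] at hn
  by_cases h : z ∈ upEvent hG v₀ ω n
  · norm_num [h] at hn
  · norm_num [h] at hn

end Drift

/-! ### Trunks and the superharmonic functions built on them. -/

section Depth

variable {V : Type u} {G : SimpleGraph V} (hG : G.IsTree) (ω : Ends G)

/-- A set of vertices that is closed under passing to the parent, meets every ray to `ω`, and does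
not branch off when one moves away from `ω`. -/
structure IsTrunk (L : Set V) : Prop where
  up_mem : ∀ x ∈ L, up hG ω x ∈ L
  exists_iterate_mem : ∀ x, ∃ k, (up hG ω)^[k] x ∈ L
  eq_of_up_eq : ∀ x ∈ L, ∀ y ∈ L, up hG ω x = up hG ω y → x = y

/-- The distance from `x` to the trunk `L` along the ray from `x` to `ω`. -/
noncomputable def depth (L : Set V) (x : V) : ℕ := sInf {k | (up hG ω)^[k] x ∈ L}

variable {hG ω} {L : Set V}

theorem IsTrunk.iterate_depth_mem (hL : IsTrunk hG ω L) (x : V) :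
    (up hG ω)^[depth hG ω L x] x ∈ L :=
  Nat.sInf_mem (hL.exists_iterate_mem x)

theorem depth_eq_zero {x : V} (hx : x ∈ L) : depth hG ω L x = 0 :=
  Nat.sInf_eq_zero.2 (Or.inl hx)

theorem IsTrunk.depth_of_notMem (hL : IsTrunk hG ω L) {x : V} (hx : x ∉ L) :
    depth hG ω L x = depth hG ω L (up hG ω x) + 1 := by
  have h1 := hL.iterate_depth_mem x
  have h2 := hL.iterate_depth_mem (up hG ω x)
  apply le_antisymm
  · exact Nat.sInf_le h2
  · cases hd : depth hG ω L x with
    | zero =>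
      rw [hd] at h1
      exact absurd h1 hx
    | succ d =>
      rw [hd] at h1
      exact Nat.succ_le_succ (Nat.sInf_le h1)

/-- The height of the point where the ray from `x` to `ω` reaches the trunk `L`. -/
noncomputable def peak (hG : G.IsTree) (ω : Ends G) (v₀ : V) (L : Set V) (x : V) : ℤ :=
  height hG ω v₀ x + depth hG ω L x

theorem peak_of_mem {v₀ x : V} (hx : x ∈ L) : peak hG ω v₀ L x = height hG ω v₀ x := by
  simp [peak, depth_eq_zero hx]

theorem IsTrunk.peak_of_notMem (hL : IsTrunk hG ω L) {v₀ x : V} (hx : x ∉ L) :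
    peak hG ω v₀ L x = peak hG ω v₀ L (up hG ω x) := by
  rw [peak, peak, hL.depth_of_notMem hx, height_up]
  push_cast
  ring

/-- The function `q⁻ᵏ tʲ`, where `k` is the height of the point where the ray from a vertex to
`ω` reaches the trunk, and `j` is the distance to this point. -/
noncomputable def trunkFun (hG : G.IsTree) (q : ℕ) (ω : Ends G) (v₀ : V) (L : Set V) (t : ℝ)
    (x : V) : ℝ :=
  (q : ℝ) ^ (-peak hG ω v₀ L x) * t ^ depth hG ω L x

theorem trunkFun_nonneg {q : ℕ} {v₀ : V} {t : ℝ} (ht : 0 ≤ t) (x : V) :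
    0 ≤ trunkFun hG q ω v₀ L t x := by
  unfold trunkFun
  positivity

end Depth

/-- Off the trunk, the values at the parent, at `x` and at the children are in the ratio 1 : t : t²,
which gives `h1`. At a trunk vertex of value `c`, the parent has value c/q, at most one child lies
on the trunk and has value cq, and the others have value ct, which gives `h2`. -/
theorem IsTrunk.transMean_trunkFun_le {V : Type u} {G : SimpleGraph V} [G.LocallyFinite] {q : ℕ}
    (hG : IsHomogeneousTree G q) (hq : 2 ≤ q) (v₀ : V) (ω : Ends G) (r : unitInterval)
    {L : Set V} (hL : IsTrunk hG.isTree ω L) {t : ℝ} (ht0 : 0 ≤ t) (ht1 : t ≤ 1)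
    (h1 : r + (1 - r) * t ^ 2 ≤ t)
    (h2 : (r : ℝ) / q + (1 - r) / q * (q * t + (q - t)) ≤ 1) (x : V) :
    transMean hG.isTree q ω r (trunkFun hG.isTree q ω v₀ L t) x ≤
      trunkFun hG.isTree q ω v₀ L t x := by
  classical
  have hq0 : (0 : ℝ) < q := by positivity
  have hq2 : (2 : ℝ) ≤ q := by exact_mod_cast hq
  have hr1 : (0 : ℝ) ≤ 1 - r := by linarith [r.2.2]
  have hc : 0 ≤ (1 - r : ℝ) / q := by positivity
  by_cases hx : x ∈ L
  · set c : ℝ := (q : ℝ) ^ (-height hG.isTree ω v₀ x) with hcdef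
    have hc0 : 0 < c := by positivity
    have hfx : trunkFun hG.isTree q ω v₀ L t x = c := by
      simp [trunkFun, depth_eq_zero hx, peak_of_mem hx, hcdef]
    have hfu : trunkFun hG.isTree q ω v₀ L t (up hG.isTree ω x) = c / q := by
      have hux := hL.up_mem x hx
      simp only [trunkFun, depth_eq_zero hux, peak_of_mem hux, height_up, pow_zero, mul_one,
        hcdef, neg_add]
      rw [zpow_add₀ hq0.ne', zpow_neg_one, div_eq_mul_inv]
    have hfc : ∀ y ∈ children hG.isTree ω x, trunkFun hG.isTree q ω v₀ L t y =
        c * t + if y ∈ L then c * (q - t) else 0 := by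
      intro y hy
      have huy := up_of_mem_children hy
      by_cases hyL : y ∈ L
      · rw [if_pos hyL]
        have hh : height hG.isTree ω v₀ y = height hG.isTree ω v₀ x - 1 := by
          rw [← huy, height_up]
          ring
        simp only [trunkFun, depth_eq_zero hyL, peak_of_mem hyL, hh, pow_zero, mul_one, hcdef]
        rw [neg_sub, sub_eq_neg_add, zpow_add₀ hq0.ne', zpow_one]
        ring
      · rw [if_neg hyL, trunkFun, hL.depth_of_notMem hyL, hL.peak_of_notMem hyL, huy,
          depth_eq_zero hx, peak_of_mem hx]
        simp [hcdef]
    have hcard : ((children hG.isTree ω x).filter (· ∈ L)).card ≤ 1 := by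
      rw [Finset.card_le_one]
      intro a ha b hb
      rw [Finset.mem_filter] at ha hb
      exact hL.eq_of_up_eq a ha.2 b hb.2
        ((up_of_mem_children ha.1).trans (up_of_mem_children hb.1).symm)
    have hsum : ∑ y ∈ children hG.isTree ω x, trunkFun hG.isTree q ω v₀ L t y ≤
        c * (q * t + (q - t)) := by
      rw [Finset.sum_congr rfl hfc, Finset.sum_add_distrib, Finset.sum_const, card_children hG,
        ← Finset.sum_filter, Finset.sum_const, nsmul_eq_mul, nsmul_eq_mul]
      have h3 : (((children hG.isTree ω x).filter (· ∈ L)).card : ℝ) ≤ 1 := by exact_mod_cast hcard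
      -- The bound counts one child on the trunk; having none only lowers the sum, because t ≤ q.
      have h4 : 0 ≤ c * (q - t) := mul_nonneg hc0.le (by linarith)
      nlinarith [mul_le_mul_of_nonneg_right h3 h4]
    rw [transMean, hfu, hfx]
    calc (r : ℝ) * (c / q) + (1 - r) / q * ∑ y ∈ children hG.isTree ω x,
          trunkFun hG.isTree q ω v₀ L t y
        ≤ (r : ℝ) * (c / q) + (1 - r) / q * (c * (q * t + (q - t))) := by gcongr
      _ = c * ((r : ℝ) / q + (1 - r) / q * (q * t + (q - t))) := by ring
      _ ≤ c * 1 := by gcongr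
      _ = c := mul_one c
  · have hd := hL.depth_of_notMem hx
    have hp := hL.peak_of_notMem (v₀ := v₀) hx
    set f := trunkFun hG.isTree q ω v₀ L t with hf
    set a := f (up hG.isTree ω x) with ha
    have ha0 : 0 ≤ a := trunkFun_nonneg ht0 _
    have hfx : f x = a * t := by
      rw [ha, hf, trunkFun, trunkFun, hd, hp, pow_succ, mul_assoc]
    have hfc : ∀ y ∈ children hG.isTree ω x, f y = a * t ^ 2 := by
      intro y hy
      have huy := up_of_mem_children hy
      have hyL : y ∉ L := fun h => hx (huy ▸ hL.up_mem y h)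
      rw [pow_two, ← mul_assoc, ← hfx, hf, trunkFun, trunkFun, hL.depth_of_notMem hyL,
        hL.peak_of_notMem hyL, huy, pow_succ, mul_assoc]
    rw [transMean, Finset.sum_congr rfl hfc, Finset.sum_const, card_children hG, nsmul_eq_mul,
      hfx]
    calc (r : ℝ) * a + (1 - r) / q * (q * (a * t ^ 2))
        = a * (r + (1 - r) * t ^ 2) := by field_simp
      _ ≤ a * t := by gcongr

theorem IsTrunk.ae_exists_tendsto_trunkFun {V : Type u} {G : SimpleGraph V} [G.LocallyFinite]
    {q : ℕ} (hG : IsHomogeneousTree G q) (hq : 2 ≤ q) (v₀ : V) (ω : Ends G) (r : unitInterval)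
    {L : Set V} (hL : IsTrunk hG.isTree ω L) {t : ℝ} (ht0 : 0 ≤ t) (ht1 : t ≤ 1)
    (h1 : r + (1 - r) * t ^ 2 ≤ t)
    (h2 : (r : ℝ) / q + (1 - r) / q * (q * t + (q - t)) ≤ 1) :
    ∀ᵐ z ∂(chainLaw hG hq v₀ ω r), ∃ c,
      Tendsto (fun n => trunkFun hG.isTree q ω v₀ L t (z n).1) atTop (𝓝 c) :=
  Supermartingale.ae_exists_tendsto_of_nonneg (supermartingale_of_transMean_le hG hq v₀ ω r
    (hL.transMean_trunkFun_le hG hq v₀ ω r ht0 ht1 h1 h2)) fun _ _ => trunkFun_nonneg ht0 _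

/-! ### The ray from `v₀` to `ω` as a trunk. -/

section NonnegativeDrift

variable {V : Type u} {G : SimpleGraph V}

/-- The vertices of the ray from `v₀` to `ω`. -/
def ancestors (hG : G.IsTree) (ω : Ends G) (v₀ : V) : Set V :=
  Set.range fun k => (up hG ω)^[k] v₀

theorem isTrunk_ancestors (hG : G.IsTree) (ω : Ends G) (v₀ : V) :
    IsTrunk hG ω (ancestors hG ω v₀) where
  up_mem := by
    rintro _ ⟨k, rfl⟩
    exact ⟨k + 1, Function.iterate_succ_apply' _ _ _⟩
  exists_iterate_mem x := by
    obtain ⟨m, n, h⟩ := exists_iterate_up_eq hG ω x v₀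
    exact ⟨m, n, h.symm⟩
  eq_of_up_eq := by
    rintro _ ⟨k, rfl⟩ _ ⟨l, rfl⟩ h
    simp only [← Function.iterate_succ_apply' (up hG ω)] at h
    have := iterate_up_injective hG ω v₀ h
    obtain rfl : k = l := by omega
    rfl

theorem iterate_depth_ancestors (hG : G.IsTree) (ω : Ends G) (v₀ x : V) :
    ∃ k : ℕ, (k : ℤ) = peak hG ω v₀ (ancestors hG ω v₀) x ∧
      (up hG ω)^[depth hG ω (ancestors hG ω v₀) x] x = (up hG ω)^[k] v₀ := by
  obtain ⟨k, hk⟩ := (isTrunk_ancestors hG ω v₀).iterate_depth_mem x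
  refine ⟨k, ?_, hk.symm⟩
  have := congrArg (height hG ω v₀) hk
  simp only [height_iterate_up, height_base, zero_add] at this
  exact this

/-- A sequence of vertices converges to `ω` if the geodesics to `ω` from its members reach the
ray from `v₀` to `ω` at points that tend to infinity. -/
theorem convergesTo_of_tendsto_peak (hG : G.IsTree) (ω : Ends G) (v₀ : V) {x : ℕ → V}
    (h : Tendsto (fun n => peak hG ω v₀ (ancestors hG ω v₀) (x n)) atTop atTop) :
    ConvergesTo x ω := by
  obtain ⟨ρ, hρ, rfl⟩ := exists_ray hG ω v₀
  refine convergesTo_of_eventually_dist_lt hG hρ fun k => ?_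
  filter_upwards [h.eventually_gt_atTop (k : ℤ)] with n hn
  rw [hρ.apply_eq_iterate_up hG, hρ.apply_eq_iterate_up hG k, Function.iterate_succ_apply',
    ← notMem_descendants_iff]
  -- A descendant of the `k`th vertex of the ray reaches the ray at index at most `k`, so its peak
  -- is at most `k`.
  rintro ⟨j, hj⟩
  have h1 : depth hG ω (ancestors hG ω (ρ 0)) (x n) ≤ j := Nat.sInf_le ⟨k, hj.symm⟩
  have h2 := congrArg (height hG ω (ρ 0)) hj
  simp only [height_iterate_up, height_base, zero_add] at h2
  unfold peak at hn
  omega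

/-- The route passes through the point where the ray from `x` to `ω` reaches the ray from `v₀`: the
first term is the depth of `x`, the second a distance along the ray. -/
theorem dist_iterate_up_ancestors_le (hG : G.IsTree) (ω : Ends G) (v₀ x : V) (m : ℕ) :
    (G.dist x ((up hG ω)^[m] v₀) : ℝ) ≤
      (peak hG ω v₀ (ancestors hG ω v₀) x - height hG ω v₀ x) +
        |(peak hG ω v₀ (ancestors hG ω v₀) x : ℝ) - m| := by
  obtain ⟨k, hk, hk'⟩ := iterate_depth_ancestors hG ω v₀ x
  have h1 := hG.connected.dist_triangle (u := x)
    (v := (up hG ω)^[depth hG ω (ancestors hG ω v₀) x] x) (w := (up hG ω)^[m] v₀)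
  rw [dist_iterate_up, hk'] at h1
  have h2 : ∀ a b : ℕ, a ≤ b → G.dist ((up hG ω)^[a] v₀) ((up hG ω)^[b] v₀) = b - a := by
    intro a b hab
    obtain ⟨c, rfl⟩ := Nat.exists_eq_add_of_le hab
    rw [Nat.add_comm a c, Function.iterate_add_apply, dist_iterate_up]
    omega
  have h3 : (G.dist ((up hG ω)^[k] v₀) ((up hG ω)^[m] v₀) : ℝ) = |(k : ℝ) - m| := by
    rcases le_total k m with h | h
    · rw [h2 k m h, Nat.cast_sub h, abs_sub_comm, abs_of_nonneg]
      exact sub_nonneg.2 (by exact_mod_cast h)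
    · rw [SimpleGraph.dist_comm, h2 m k h, Nat.cast_sub h, abs_of_nonneg]
      exact sub_nonneg.2 (by exact_mod_cast h)
  have h4 : (peak hG ω v₀ (ancestors hG ω v₀) x : ℝ) = k := by exact_mod_cast hk.symm
  have h5 : (peak hG ω v₀ (ancestors hG ω v₀) x : ℝ) - height hG ω v₀ x =
      depth hG ω (ancestors hG ω v₀) x := by
    unfold peak
    push_cast
    ring
  rw [h5, h4, ← h3]
  exact_mod_cast h1

/-- The peak can change only at a step that ends on the ray, and there it equals the height. Hence
it never exceeds the running maximum of the height. -/
theorem exists_peak_le_height (hG : G.IsTree) (ω : Ends G) (v₀ : V) {x : ℕ → V} (h0 : x 0 = v₀)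
    (hx : ∀ n, G.Adj (x n) (x (n + 1))) (n : ℕ) :
    ∃ i ≤ n, peak hG ω v₀ (ancestors hG ω v₀) (x n) ≤ height hG ω v₀ (x i) := by
  have hL := isTrunk_ancestors hG ω v₀
  induction n with
  | zero => exact ⟨0, le_rfl, (peak_of_mem (h0 ▸ ⟨0, rfl⟩)).le⟩
  | succ n ih =>
    obtain ⟨i, hi, h⟩ := ih
    by_cases hmem : x (n + 1) ∈ ancestors hG ω v₀
    · exact ⟨n + 1, le_rfl, (peak_of_mem hmem).le⟩
    · refine ⟨i, by omega, le_trans (le_of_eq ?_) h⟩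
      rcases eq_up_or_up_eq hG ω (hx n) with h1 | h1
      · rw [h1] at hmem ⊢
        rw [hL.peak_of_notMem fun h => hmem (hL.up_mem _ h)]
      · rw [hL.peak_of_notMem hmem, h1]

end NonnegativeDrift

/-- The growth rate of the running maximum of a sequence of nonnegative rate of growth. -/
theorem tendsto_div_of_le_running_max {h p : ℕ → ℝ} {s : ℝ} (hs : 0 ≤ s)
    (hh : Tendsto (fun n : ℕ => h n / n) atTop (𝓝 s)) (hle : ∀ n, h n ≤ p n)
    (hmax : ∀ n, ∃ i ≤ n, p n ≤ h i) : Tendsto (fun n : ℕ => p n / n) atTop (𝓝 s) := by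
  rw [tendsto_order]
  constructor
  · intro a ha
    filter_upwards [hh.eventually (lt_mem_nhds ha)] with n hn
    exact hn.trans_le (div_le_div_of_nonneg_right (hle n) n.cast_nonneg)
  · intro b hb
    obtain ⟨c, hsc, hcb⟩ := exists_between hb
    obtain ⟨N, hN⟩ := eventually_atTop.1
      ((hh.eventually (gt_mem_nhds hsc)).and (eventually_gt_atTop 0))
    -- The maximum may be attained before time `N`, where the ratio is not controlled; these
    -- finitely many values are at most `B`, hence at most `c * n` for large `n`.
    obtain ⟨B, hB⟩ := ((Set.finite_lt_nat N).image h).bddAbove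
    have hc : 0 < c := hs.trans_lt hsc
    filter_upwards [eventually_ge_atTop N, eventually_gt_atTop 0,
      (tendsto_natCast_atTop_atTop.const_mul_atTop hc).eventually_ge_atTop B] with n hn hn0 hnB
    have hn0' : (0 : ℝ) < n := by exact_mod_cast hn0
    rw [div_lt_iff₀ hn0']
    refine lt_of_le_of_lt ?_ (mul_lt_mul_of_pos_right hcb hn0')
    obtain ⟨i, hi, hpi⟩ := hmax n
    refine hpi.trans ?_
    rcases lt_or_ge i N with hiN | hiN
    · exact (hB ⟨i, hiN, rfl⟩).trans hnB
    · obtain ⟨h1, h2⟩ := hN i hiN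
      rw [div_lt_iff₀ (by exact_mod_cast h2)] at h1
      refine h1.le.trans (mul_le_mul_of_nonneg_left ?_ hc.le)
      exact_mod_cast hi

/-- A positive limit would bound `p` above, against `hp`. With the limit at most 0, the terms
eventually drop below every `a ^ (-K)`. -/
theorem tendsto_atTop_of_tendsto_zpow_neg {a : ℝ} (ha : 1 < a) {p : ℕ → ℤ} {c : ℝ}
    (h : Tendsto (fun n => a ^ (-p n)) atTop (𝓝 c)) (hp : ∀ K, ∃ n, K ≤ p n) :
    Tendsto p atTop atTop := by
  have ha0 : 0 < a := by linarith
  have hc : c ≤ 0 := by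
    by_contra! hc
    obtain ⟨M, hM⟩ := pow_unbounded_of_one_lt (c / 2)⁻¹ ha
    obtain ⟨N, hN⟩ := eventually_atTop.1 (h.eventually (lt_mem_nhds (half_lt_self hc)))
    obtain ⟨B, hB⟩ := ((Set.finite_lt_nat N).image p).bddAbove
    obtain ⟨n, hn⟩ := hp (max B M + 1)
    rcases lt_or_ge n N with h1 | h1
    · have := hB ⟨n, h1, rfl⟩
      have := le_max_left B (M : ℤ)
      omega
    · have h2 := hN n h1
      have h3 : a ^ M ≤ a ^ p n := by
        rw [← zpow_natCast]
        exact zpow_le_zpow_right₀ ha.le (by have := le_max_right B (M : ℤ); omega)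
      rw [zpow_neg, lt_inv_comm₀ (by positivity) (by positivity)] at h2
      linarith
  rw [tendsto_atTop]
  intro K
  filter_upwards [h.eventually (gt_mem_nhds (hc.trans_lt (zpow_pos ha0 (-K))))] with n hn
  have := (zpow_lt_zpow_iff_right₀ ha).1 hn
  omega

/-! ### The case r ≥ 1/2: convergence to `ω` and its rate. -/

section NonnegativeDriftChain

variable {V : Type u} {G : SimpleGraph V} [G.LocallyFinite] {q : ℕ}
  (hG : IsHomogeneousTree G q) (hq : 2 ≤ q) (v₀ : V) (ω : Ends G) (r : unitInterval)

/-- For t = 1 the trunk function is `q` to the power minus the peak, and superharmonicity on the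
trunk reads r + (1-r)(2q-1) ≤ q, that is, r ≥ 1/2. Its convergence forces the peak to infinity,
since the heights, and with them the peaks, are unbounded above. -/
theorem ae_tendsto_peak (hr : (1 / 2 : ℝ) ≤ r) : ∀ᵐ z ∂(chainLaw hG hq v₀ ω r),
    Tendsto (fun n => peak hG.isTree ω v₀ (ancestors hG.isTree ω v₀) (z n).1) atTop atTop := by
  have hq1 : (2 : ℝ) ≤ q := by exact_mod_cast hq
  have h := (isTrunk_ancestors hG.isTree ω v₀).ae_exists_tendsto_trunkFun hG hq v₀ ω r
    zero_le_one le_rfl (by simp) (by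
      rw [div_mul_eq_mul_div, ← add_div, div_le_one (by linarith)]
      nlinarith)
  filter_upwards [h, ae_exists_height_ge hG hq v₀ ω r hr] with z ⟨c, hc⟩ hz
  simp only [trunkFun, one_pow, mul_one] at hc
  refine tendsto_atTop_of_tendsto_zpow_neg (by linarith) hc fun K => ?_
  obtain ⟨n, hn⟩ := hz K
  refine ⟨n, hn.trans ?_⟩
  unfold peak
  omega

theorem ae_convergesTo_of_half_le (hr : (1 / 2 : ℝ) ≤ r) :
    ∀ᵐ w ∂(markovMeasure hG hq v₀ ω r), ConvergesTo (proj w) ω :=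
  ae_markovMeasure hG hq v₀ ω r ((ae_tendsto_peak hG hq v₀ ω r hr).mono fun _ hz =>
    convergesTo_of_tendsto_peak hG.isTree ω v₀ hz)

/-- Height, peak and `⌊s * n⌋₊` all grow at the rate `s`, so both terms of
`dist_iterate_up_ancestors_le` are o(n). -/
theorem ae_tendsto_dist_div (hr : (1 / 2 : ℝ) ≤ r) {ρ : Ray G} (hρ : ρ.Represents ω)
    (h0 : ρ 0 = v₀) : ∀ᵐ w ∂(markovMeasure hG hq v₀ ω r),
      Tendsto (fun n : ℕ => (G.dist (proj w n) (ρ ⌊(2 * (r : ℝ) - 1) * n⌋₊) : ℝ) / n)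
        atTop (𝓝 0) := by
  set s : ℝ := 2 * r - 1 with hs
  have hs0 : 0 ≤ s := by linarith
  refine ae_markovMeasure hG hq v₀ ω r (p := fun z =>
    Tendsto (fun n : ℕ => (G.dist (z n).1 (ρ ⌊s * n⌋₊) : ℝ) / n) atTop (𝓝 0)) ?_
  filter_upwards [ae_tendsto_height_div hG hq v₀ ω r, ae_adj hG hq v₀ ω r] with z hz hadj
  have hp : Tendsto (fun n : ℕ =>
      (peak hG.isTree ω v₀ (ancestors hG.isTree ω v₀) (z n).1 : ℝ) / n) atTop (𝓝 s) := by
    refine tendsto_div_of_le_running_max hs0 hz (fun n => ?_) fun n => ?_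
    · have : height hG.isTree ω v₀ (z n).1 ≤
          peak hG.isTree ω v₀ (ancestors hG.isTree ω v₀) (z n).1 := by
        unfold peak
        omega
      exact_mod_cast this
    · obtain ⟨i, hi, h⟩ := exists_peak_le_height hG.isTree ω v₀ (x := fun n => (z n).1)
        (z 0).eq_base hadj n
      exact ⟨i, hi, by exact_mod_cast h⟩
  have hm : Tendsto (fun n : ℕ => (⌊s * n⌋₊ : ℝ) / n) atTop (𝓝 s) :=
    (tendsto_nat_floor_mul_div_atTop hs0).comp tendsto_natCast_atTop_atTop
  have hlim := (hp.sub hz).add (hp.sub hm).abs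
  rw [sub_self, abs_zero, add_zero] at hlim
  refine squeeze_zero (fun n => by positivity) (fun n => ?_) hlim
  rw [hρ.apply_eq_iterate_up hG.isTree, h0, ← sub_div, ← sub_div, abs_div, Nat.abs_cast,
    ← add_div]
  exact div_le_div_of_nonneg_right (dist_iterate_up_ancestors_le hG.isTree ω v₀ _ _)
    n.cast_nonneg

end NonnegativeDriftChain

/-! ### Descending sequences and the ends other than `ω`. -/

section Descending

variable {V : Type u} {G : SimpleGraph V} {hG : G.IsTree} {ω : Ends G}

/-- The ray formed by a sequence of vertices each of which is a child of the preceding one. -/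
def descendingRay (u : ℕ → V) (hu : ∀ m, up hG ω (u (m + 1)) = u m) : Ray G where
  toFun := u
  adj m := by
    rw [← hu m]
    exact (adj_up hG ω _).symm
  inj := by
    have h : ∀ m, height hG ω (u 0) (u m) = -m := by
      intro m
      induction m with
      | zero => simp
      | succ m ih =>
        have := height_up hG ω (u 0) (u (m + 1))
        rw [hu, ih] at this
        push_cast
        omega
    intro a b hab
    have := h a
    rw [hab, h b] at this
    omega

theorem eq_iterate_up_of_descending {u : ℕ → V} (hu : ∀ m, up hG ω (u (m + 1)) = u m) (k i : ℕ) :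
    u k = (up hG ω)^[i] (u (k + i)) := by
  induction i with
  | zero => rfl
  | succ i ih => rw [Function.iterate_succ_apply, ← Nat.add_assoc, hu, ← ih]

theorem height_of_descending {u : ℕ → V} (hu : ∀ m, up hG ω (u (m + 1)) = u m) (v₀ : V) (k : ℕ) :
    height hG ω v₀ (u k) = height hG ω v₀ (u 0) - k := by
  have := eq_iterate_up_of_descending hu 0 k
  rw [Nat.zero_add] at this
  rw [this, height_iterate_up]
  ring

/-- The vertex `u` is the ancestor of `x N` at height `m`. Leaving its descendants requires a step
from `u` to its parent, at the forbidden height `m + 1`. -/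
theorem eventually_mem_descendants {x : ℕ → V} (hx : ∀ n, G.Adj (x n) (x (n + 1))) {v₀ : V} {m : ℤ}
    {N : ℕ} (hN : ∀ n ≥ N, height hG ω v₀ (x n) ≤ m) :
    ∃ u, height hG ω v₀ u = m ∧ ∀ n ≥ N, x n ∈ descendants hG ω u := by
  have h0 := hN N le_rfl
  refine ⟨(up hG ω)^[(m - height hG ω v₀ (x N)).toNat] (x N), ?_, fun n hn => ?_⟩
  · rw [height_iterate_up, Int.toNat_of_nonneg (by omega)]
    ring
  · generalize hu : (up hG ω)^[(m - height hG ω v₀ (x N)).toNat] (x N) = u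
    have hum : height hG ω v₀ u = m := by
      rw [← hu, height_iterate_up, Int.toNat_of_nonneg (by omega)]
      ring
    induction n, hn using Nat.le_induction with
    | base => exact ⟨_, hu⟩
    | succ n hn ih =>
      obtain ⟨k, hk⟩ := ih
      rcases eq_up_or_up_eq hG ω (hx n) with h | h
      · cases k with
        | zero =>
          have h1 := hN (n + 1) (by omega)
          have h2 : x n = u := hk
          rw [h, height_up, h2, hum] at h1
          omega
        | succ k => exact ⟨k, by rw [h]; exact hk⟩
      · refine ⟨k + 1, ?_⟩
        rw [Function.iterate_succ_apply, h]
        exact hk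

/-- For each `m` the path is finally trapped below one vertex of height `-m`. A late vertex of the
path lies below both `u m` and `u (m + 1)`, and comparing heights on its ray to `ω` shows that the
former is the parent of the latter. -/
theorem exists_descending {x : ℕ → V} (hx : ∀ n, G.Adj (x n) (x (n + 1))) {v₀ : V}
    (hh : Tendsto (fun n => height hG ω v₀ (x n)) atTop atBot) :
    ∃ u : ℕ → V, (∀ m, up hG ω (u (m + 1)) = u m) ∧
      ∀ m, ∀ᶠ n in atTop, x n ∈ descendants hG ω (u m) := by
  have key : ∀ m : ℕ, ∃ u, height hG ω v₀ u = -m ∧ ∀ᶠ n in atTop, x n ∈ descendants hG ω u := by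
    intro m
    obtain ⟨N, hN⟩ := eventually_atTop.1 (hh.eventually_le_atBot (-(m : ℤ)))
    obtain ⟨u, hu, h⟩ := eventually_mem_descendants hx hN
    exact ⟨u, hu, eventually_atTop.2 ⟨N, h⟩⟩
  choose u hu hu' using key
  refine ⟨u, fun m => ?_, hu'⟩
  obtain ⟨n, ⟨a, ha⟩, ⟨b, hb⟩⟩ := ((hu' m).and (hu' (m + 1))).exists
  have ha' := congrArg (height hG ω v₀) ha
  have hb' := congrArg (height hG ω v₀) hb
  rw [height_iterate_up, hu] at ha' hb'
  obtain rfl : a = b + 1 := by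
    push_cast at hb'
    omega
  rw [← hb, ← ha, Function.iterate_succ_apply']

/-- The ray through `(a, b)` merges with `σ`, and a decrease of the distance beyond the merging
point propagates back to its first edge by `Ray.dist_add_of_lt`. -/
theorem eventually_dist_lt_of_directed (hG : G.IsTree) {x : ℕ → V} {ξ : Ends G} {σ : Ray G}
    (hσ : σ.Represents ξ)
    (h : ∀ k, ∀ᶠ i in atTop, G.dist (x i) (σ (k + 1)) < G.dist (x i) (σ k)) {a b : V}
    (hab : Directed ξ a b) : ∀ᶠ i in atTop, G.dist (x i) b < G.dist (x i) a := by
  obtain ⟨ρ, hρ, rfl, rfl⟩ := hab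
  obtain ⟨m, n, hmn⟩ : ρ ≈ σ := Quotient.exact (hρ.trans hσ.symm)
  filter_upwards [h (n + 1)] with i hi
  have h1 : G.dist (x i) (ρ (m + 1 + 1)) < G.dist (x i) (ρ (m + 1)) := by
    rw [hmn 1, Nat.add_assoc, hmn (1 + 1)]
    exact hi
  have h2 := ρ.dist_add_of_lt hG h1
  have h3 := hG.connected.dist_triangle (u := x i) (v := ρ (m + 1)) (w := ρ 1)
  have h4 := (ρ.shift 1).dist_eq hG m
  simp only [Ray.shift_apply, Nat.add_zero, Nat.add_comm 1 m] at h4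
  rw [SimpleGraph.dist_comm (u := ρ (m + 1))] at h3
  omega

/-- A path along which the height tends to `-∞` converges to an end other than `ω`. -/
theorem exists_end_of_tendsto_height (hG : G.IsTree) (ω : Ends G) {x : ℕ → V}
    (hx : ∀ n, G.Adj (x n) (x (n + 1))) {v₀ : V}
    (hh : Tendsto (fun n => height hG ω v₀ (x n)) atTop atBot) :
    ∃ ξ : Ends G, ξ ≠ ω ∧ ConvergesTo x ξ ∧ ∀ a b, Directed ξ a b ↔
      G.Adj a b ∧ ∀ᶠ i in atTop, G.dist (x i) b < G.dist (x i) a := by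
  obtain ⟨u, hu, hx'⟩ := exists_descending hx hh
  obtain ⟨ξ, hξ⟩ : ∃ ξ, (descendingRay u hu).Represents ξ := ⟨_, rfl⟩
  have hd : ∀ k, ∀ᶠ i in atTop, G.dist (x i) (descendingRay u hu (k + 1)) <
      G.dist (x i) (descendingRay u hu k) := by
    intro k
    filter_upwards [hx' (k + 1)] with i hi
    change G.dist (x i) (u (k + 1)) < G.dist (x i) (u k)
    rw [← hu k]
    exact (mem_descendants_iff hG ω).1 hi
  refine ⟨ξ, ?_, convergesTo_of_eventually_dist_lt hG hξ hd, fun a b => ⟨fun hab => ⟨hab.adj,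
    eventually_dist_lt_of_directed hG hξ hd hab⟩, fun ⟨hab, h⟩ => ?_⟩⟩
  · rintro rfl
    have h1 : u 1 = up hG ξ (u 0) := (directed_iff_eq_up hG).1 (hξ.directed 0)
    have h2 := up_up_ne hG ξ (u 1)
    rw [hu 0, ← h1] at h2
    exact h2 rfl
  -- Both `b` and the neighbour of `a` towards `ξ` are closer than `a` to some `x i`, so they
  -- coincide.
  · obtain ⟨i, h1, h2⟩ := (h.and (eventually_dist_lt_of_directed hG hξ hd
      (directed_up hG ξ a))).exists
    rw [eq_of_dist_lt hG hab (adj_up hG ξ a) h1 h2]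
    exact directed_up hG ξ a

/-- The line through a descending sequence of vertices. -/
def lineThrough (hG : G.IsTree) (ω : Ends G) (u : ℕ → V) : Set V :=
  {x | ∃ k i, (up hG ω)^[i] (u k) = x}

theorem isTrunk_lineThrough {u : ℕ → V} (hu : ∀ m, up hG ω (u (m + 1)) = u m) :
    IsTrunk hG ω (lineThrough hG ω u) where
  up_mem := by
    rintro _ ⟨k, i, rfl⟩
    exact ⟨k, i + 1, Function.iterate_succ_apply' _ _ _⟩
  exists_iterate_mem x := by
    obtain ⟨m, n, h⟩ := exists_iterate_up_eq hG ω x (u 0)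
    exact ⟨m, 0, n, h.symm⟩
  eq_of_up_eq := by
    rintro _ ⟨k, i, rfl⟩ _ ⟨l, j, rfl⟩ h
    -- Both points become iterated parents of the one vertex `u (k + l)`, whose iterates are
    -- distinct.
    rw [eq_iterate_up_of_descending hu k l, eq_iterate_up_of_descending hu l k, Nat.add_comm l k,
      ← Function.iterate_add_apply, ← Function.iterate_add_apply] at h ⊢
    rw [← Function.iterate_succ_apply' (up hG ω), ← Function.iterate_succ_apply' (up hG ω)] at h
    have := iterate_up_injective hG ω _ h
    rw [show i + l = j + k by omega]

/-- If a path follows a descending sequence of vertices, then it visits all but finitely many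
of them. -/
theorem exists_eq_of_eventually_mem_descendants {u : ℕ → V}
    (hu : ∀ m, up hG ω (u (m + 1)) = u m) {x : ℕ → V} (hx : ∀ n, G.Adj (x n) (x (n + 1)))
    (h : ∀ m, ∀ᶠ n in atTop, x n ∈ descendants hG ω (u m)) :
    ∀ᶠ m in atTop, ∃ n, x n = u m := by
  classical
  -- For such `m` the vertex `u m` is lower than `x 0`, so the path starts outside the descendants
  -- of `u m` and can enter them only through `u m`.
  filter_upwards [eventually_gt_atTop (height hG ω (x 0) (u 0)).toNat] with m hm
  have h0 : x 0 ∉ descendants hG ω (u m) := by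
    intro hmem
    have := height_le_of_mem_descendants hG ω (x 0) hmem
    rw [height_of_descending hu, height_base] at this
    omega
  have hex := (h m).exists
  have hfind := Nat.find_spec hex
  cases hn : Nat.find hex with
  | zero =>
    rw [hn] at hfind
    exact absurd hfind h0
  | succ n =>
    rw [hn] at hfind
    exact ⟨n + 1, eq_of_adj_of_mem_descendants hG ω (hx n)
      (Nat.find_min hex (m := n) (by omega)) hfind⟩

end Descending

/-! ### The Borel structure of the space of ends. -/

section EndsTopology

variable {V : Type u} {G : SimpleGraph V}

/-- There are countably many vertices, so the subbasis is countable and generates the Borel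
σ-algebra. -/
theorem borel_ends (hG : G.IsTree) [G.LocallyFinite] : (inferInstance : MeasurableSpace (Ends G)) =
    MeasurableSpace.generateFrom {S | ∃ x y : V, S = {ξ | Directed ξ x y}} := by
  have := countable_vertices hG
  have hc : {S : Set (Ends G) | ∃ x y : V, S = {ξ | Directed ξ x y}}.Countable := by
    have : {S : Set (Ends G) | ∃ x y : V, S = {ξ | Directed ξ x y}} =
        Set.range fun p : V × V => {ξ : Ends G | Directed ξ p.1 p.2} := by
      ext S
      constructor
      · rintro ⟨x, y, rfl⟩
        exact ⟨(x, y), rfl⟩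
      · rintro ⟨p, rfl⟩
        exact ⟨p.1, p.2, rfl⟩
    rw [this]
    exact Set.countable_range _
  have : SecondCountableTopology (Ends G) := ⟨⟨_, hc, rfl⟩⟩
  exact borel_eq_generateFrom_of_subbasis rfl

theorem measurableSet_directed (x y : V) : MeasurableSet {ξ : Ends G | Directed ξ x y} := by
  have : BorelSpace (Ends G) := ⟨rfl⟩
  have h : IsOpen {ξ : Ends G | Directed ξ x y} :=
    TopologicalSpace.isOpen_generateFrom_of_mem ⟨x, y, rfl⟩
  exact h.measurableSet

theorem measurable_of_directed (hG : G.IsTree) [G.LocallyFinite] {Ω : Type*} [MeasurableSpace Ω]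
    {f : Ω → Ends G} (hf : ∀ x y, MeasurableSet (f ⁻¹' {ξ | Directed ξ x y})) : Measurable f := by
  intro s hs
  have hs' : MeasurableSet[MeasurableSpace.generateFrom
      {S : Set (Ends G) | ∃ x y : V, S = {ξ | Directed ξ x y}}] s := borel_ends hG ▸ hs
  refine measurable_generateFrom ?_ hs'
  rintro _ ⟨x, y, rfl⟩
  exact hf x y

end EndsTopology

/-! ### The case r < 1/2: a random limit end whose law has no atoms. -/

section NegativeDrift

variable {V : Type u} {G : SimpleGraph V} [G.LocallyFinite] {q : ℕ}
  (hG : IsHomogeneousTree G q) (hq : 2 ≤ q) (v₀ : V) (ω : Ends G) (r : unitInterval)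

theorem ae_tendsto_height_atBot (hr : (r : ℝ) < 1 / 2) : ∀ᵐ z ∂(chainLaw hG hq v₀ ω r),
    Tendsto (fun n => height hG.isTree ω v₀ (z n).1) atTop atBot := by
  filter_upwards [ae_tendsto_height_div hG hq v₀ ω r] with z hz
  have h := hz.neg_mul_atTop (by linarith) tendsto_natCast_atTop_atTop
  rw [← tendsto_intCast_atBot_iff (R := ℝ)]
  refine h.congr' ?_
  filter_upwards [eventually_gt_atTop 0] with n hn
  field_simp

open Classical in
/-- The end to which a path converges if the height tends to `-∞` along it, and `ω` for the other
paths. -/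
noncomputable def limitEnd (w : Paths G v₀) : Ends G :=
  if h : Tendsto (fun n => height hG.isTree ω v₀ (proj w n)) atTop atBot then
    (exists_end_of_tendsto_height hG.isTree ω w.2 h).choose
  else ω

variable {v₀ ω}

/-- The last clause reads off the edges directed to the limit end from the tail of the path. It
yields both the measurability of `limitEnd` and the zero-one argument against ergodicity. -/
theorem limitEnd_spec {w : Paths G v₀}
    (h : Tendsto (fun n => height hG.isTree ω v₀ (proj w n)) atTop atBot) :
    limitEnd hG v₀ ω w ≠ ω ∧ ConvergesTo (proj w) (limitEnd hG v₀ ω w) ∧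
      ∀ a b, Directed (limitEnd hG v₀ ω w) a b ↔
        G.Adj a b ∧ ∀ᶠ i in atTop, G.dist (proj w i) b < G.dist (proj w i) a := by
  rw [limitEnd, dif_pos h]
  exact (exists_end_of_tendsto_height hG.isTree ω w.2 h).choose_spec

theorem limitEnd_of_not_tendsto {w : Paths G v₀}
    (h : ¬ Tendsto (fun n => height hG.isTree ω v₀ (proj w n)) atTop atBot) :
    limitEnd hG v₀ ω w = ω := by
  rw [limitEnd, dif_neg h]

omit [G.LocallyFinite] in
theorem measurable_proj_comp {α : Type*} [MeasurableSpace α] (f : V → α) (n : ℕ) :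
    Measurable fun w : Paths G v₀ => f (proj w n) :=
  (Measurable.of_discrete (f := fun v : Level G v₀ n => f v.1)).comp
    ((measurable_pi_apply n).comp measurable_subtype_coe)

omit [G.LocallyFinite] in
theorem measurableSet_eventually_proj (A : Set V) :
    MeasurableSet {w : Paths G v₀ | ∀ᶠ i in atTop, proj w i ∈ A} := by
  have : {w : Paths G v₀ | ∀ᶠ i in atTop, proj w i ∈ A} =
      ⋃ N, ⋂ i, ⋂ (_ : N ≤ i), {w | proj w i ∈ A} := by
    ext w
    simp [eventually_atTop]
  rw [this]
  exact MeasurableSet.iUnion fun N => MeasurableSet.iInter fun i => MeasurableSet.iInter fun _ =>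
    measurableSet_setOfPred.2 (measurable_proj_comp (· ∈ A) i)

variable (v₀ ω)

theorem measurable_limitEnd : Measurable (limitEnd hG v₀ ω) := by
  refine measurable_of_directed hG.isTree fun a b => ?_
  have hgood : MeasurableSet {w : Paths G v₀ |
      Tendsto (fun n => height hG.isTree ω v₀ (proj w n)) atTop atBot} :=
    measurableSet_tendsto atBot fun n => measurable_proj_comp _ n
  have : limitEnd hG v₀ ω ⁻¹' {ξ | Directed ξ a b} =
      ({w | Tendsto (fun n => height hG.isTree ω v₀ (proj w n)) atTop atBot} ∩
        ({_w | G.Adj a b} ∩ {w | ∀ᶠ i in atTop, proj w i ∈ {x | G.dist x b < G.dist x a}})) ∪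
      ({w | Tendsto (fun n => height hG.isTree ω v₀ (proj w n)) atTop atBot}ᶜ ∩
        {_w | Directed ω a b}) := by
    ext w
    by_cases h : Tendsto (fun n => height hG.isTree ω v₀ (proj w n)) atTop atBot
    · simp [h, (limitEnd_spec hG h).2.2]
    · simp [h, limitEnd_of_not_tendsto hG h]
  rw [this]
  exact (hgood.inter ((MeasurableSet.const _).inter (measurableSet_eventually_proj _))).union
    (hgood.compl.inter (MeasurableSet.const _))

theorem ae_tendsto_height_proj_atBot (hr : (r : ℝ) < 1 / 2) : ∀ᵐ w ∂(markovMeasure hG hq v₀ ω r),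
    Tendsto (fun n => height hG.isTree ω v₀ (proj w n)) atTop atBot :=
  ae_markovMeasure hG hq v₀ ω r (ae_tendsto_height_atBot hG hq v₀ ω r hr)

/-- Almost surely, the path does not follow a given descending sequence of vertices. -/
theorem ae_not_eventually_mem_descendants (hr : (r : ℝ) < 1 / 2) {u : ℕ → V}
    (hu : ∀ m, up hG.isTree ω (u (m + 1)) = u m) : ∀ᵐ w ∂(markovMeasure hG hq v₀ ω r),
      ¬ ∀ m, ∀ᶠ n in atTop, proj w n ∈ descendants hG.isTree ω (u m) := by
  have hr0 := r.2.1
  have hq1 : (2 : ℝ) ≤ q := by exact_mod_cast hq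
  have h1r : (0 : ℝ) < 1 - r := by linarith
  -- This is the root other than 1 of r + (1-r)t² = t; with it both superharmonicity conditions hold
  -- with equality.
  set t : ℝ := r / (1 - r) with ht
  have htr : t * (1 - r) = r := div_mul_cancel₀ _ h1r.ne'
  have ht0 : 0 ≤ t := by positivity
  have hlim := (isTrunk_lineThrough hu).ae_exists_tendsto_trunkFun hG hq v₀ ω r ht0
    ((div_le_one h1r).2 (by linarith)) (by nlinarith) (by
      rw [div_mul_eq_mul_div, ← add_div, div_le_one (by linarith)]
      nlinarith)
  filter_upwards [ae_markovMeasure hG hq v₀ ω r hlim] with w ⟨c, hc⟩ hw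
  -- A convergent sequence is bounded, but a path following `u` visits `u m` for all large `m`, and
  -- there the trunk function is `q` to the power `m` minus the height of `u 0`.
  obtain ⟨B, hB⟩ := hc.bddAbove_range
  obtain ⟨M, hM⟩ := pow_unbounded_of_one_lt B (by linarith : (1 : ℝ) < q)
  obtain ⟨m, ⟨n, hn⟩, hm⟩ := ((exists_eq_of_eventually_mem_descendants hu w.2 hw).and
    (eventually_ge_atTop (M + (height hG.isTree ω v₀ (u 0)).toNat))).exists
  have hmem : u m ∈ lineThrough hG.isTree ω u := ⟨m, 0, rfl⟩
  have h1 := hB ⟨n, rfl⟩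
  have h2 : (w.1 n).1 = u m := hn
  simp only [trunkFun, h2, depth_eq_zero hmem, peak_of_mem hmem, pow_zero, mul_one] at h1
  rw [height_of_descending hu] at h1
  have h3 : (q : ℝ) ^ M ≤ (q : ℝ) ^ (-(height hG.isTree ω v₀ (u 0) - m)) := by
    rw [← zpow_natCast]
    exact zpow_le_zpow_right₀ (by linarith) (by omega)
  linarith

/-- The law of the limit end has no atoms. -/
theorem map_limitEnd_singleton (hr : (r : ℝ) < 1 / 2) (ξ : Ends G) :
    (markovMeasure hG hq v₀ ω r).map (limitEnd hG v₀ ω) {ξ} = 0 := by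
  have := countable_vertices hG.isTree
  have hset : MeasurableSet {ξ} := by
    have : {ξ} = ⋂ a, ⋂ b, ⋂ (_ : Directed ξ a b), {η : Ends G | Directed η a b} := by
      ext η
      simp only [Set.mem_singleton_iff, Set.mem_iInter]
      exact ⟨fun h a b hab => h ▸ hab, fun h => (Ends.ext_directed hG.isTree v₀ h).symm⟩
    rw [this]
    exact MeasurableSet.iInter fun a => MeasurableSet.iInter fun b => MeasurableSet.iInter fun _ =>
      measurableSet_directed a b
  rw [Measure.map_apply (measurable_limitEnd hG v₀ ω) hset, measure_eq_zero_iff_ae_notMem]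
  -- A single path converging to `ξ` supplies a descending sequence leading to `ξ`; every other path
  -- with limit `ξ` must follow it. If there is no such path, almost no path has limit `ξ`.
  by_cases hex : ∃ w, Tendsto (fun n => height hG.isTree ω v₀ (proj w n)) atTop atBot ∧
      limitEnd hG v₀ ω w = ξ
  · obtain ⟨w', hw', hξ⟩ := hex
    obtain ⟨u, hu, hwu⟩ := exists_descending w'.2 hw'
    filter_upwards [ae_tendsto_height_proj_atBot hG hq v₀ ω r hr, ae_not_eventually_mem_descendants hG hq v₀ ω r hr hu]
      with w hw hn heq
    refine hn fun m => ?_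
    have hd : Directed (limitEnd hG v₀ ω w') (up hG.isTree ω (u m)) (u m) := by
      rw [(limitEnd_spec hG hw').2.2]
      exact ⟨(adj_up hG.isTree ω _).symm, (hwu m).mono fun n hn =>
        (mem_descendants_iff hG.isTree ω).1 hn⟩
    rw [hξ, ← heq, (limitEnd_spec hG hw).2.2] at hd
    exact hd.2.mono fun n hn => (mem_descendants_iff hG.isTree ω).2 hn
  · filter_upwards [ae_tendsto_height_proj_atBot hG hq v₀ ω r hr] with w hw heq
    exact hex ⟨w, hw, heq⟩

end NegativeDrift

/-! ### Tail events and central measures. -/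

section Tail

variable {V : Type u} {G : SimpleGraph V} {v₀ : V}

/-- The set of infinite paths that agree with `w` between the times `n` and `m`. -/
def tailCylinder (w : Paths G v₀) (n m : ℕ) : Set (Paths G v₀) :=
  {z | ∀ k, n ≤ k → k ≤ m → z.1 k = w.1 k}

/-- The σ-algebra generated by the vertices of a path from time `n` on. -/
@[reducible]
def tailAlgebra (G : SimpleGraph V) (v₀ : V) (n : ℕ) : MeasurableSpace (Paths G v₀) :=
  MeasurableSpace.generateFrom {S | ∃ w m, S = tailCylinder w n m}

theorem tailCylinder_eq_of_mem {w z : Paths G v₀} {n m : ℕ} (h : z ∈ tailCylinder w n m) :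
    tailCylinder w n m = tailCylinder z n m := by
  ext y
  exact ⟨fun hy k h1 h2 => (hy k h1 h2).trans (h k h1 h2).symm,
    fun hy k h1 h2 => (hy k h1 h2).trans (h k h1 h2)⟩

theorem isPiSystem_tailCylinder (n : ℕ) :
    IsPiSystem {S : Set (Paths G v₀) | ∃ w m, S = tailCylinder w n m} := by
  rintro _ ⟨w, m, rfl⟩ _ ⟨w', m', rfl⟩ ⟨z, hz, hz'⟩
  refine ⟨z, max m m', ?_⟩
  rw [tailCylinder_eq_of_mem hz, tailCylinder_eq_of_mem hz']
  ext y
  simp only [tailCylinder, Set.mem_inter_iff, Set.mem_ofPred_eq, le_max_iff]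
  constructor
  · rintro ⟨h1, h2⟩ k hk (h | h)
    exacts [h1 k hk h, h2 k hk h]
  · exact fun h => ⟨fun k hk hm => h k hk (Or.inl hm), fun k hk hm => h k hk (Or.inr hm)⟩

theorem measurableSet_tailCylinder (w : Paths G v₀) (n m : ℕ) :
    MeasurableSet (tailCylinder w n m) := by
  have : tailCylinder w n m = ⋂ k, ⋂ (_ : n ≤ k), ⋂ (_ : k ≤ m), {z | z.1 k = w.1 k} := by
    ext z
    simp [tailCylinder]
  rw [this]
  refine MeasurableSet.iInter fun k => MeasurableSet.iInter fun _ => MeasurableSet.iInter fun _ => ?_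
  exact (MeasurableSet.of_discrete (s := {w.1 k})).preimage
    ((measurable_pi_apply k).comp measurable_subtype_coe)

theorem tailAlgebra_le (n : ℕ) : tailAlgebra G v₀ n ≤ Subtype.instMeasurableSpace := by
  refine MeasurableSpace.generateFrom_le ?_
  rintro _ ⟨w, m, rfl⟩
  exact measurableSet_tailCylinder w n m

/-- The event is a finite union over the vertex sequences up to time `i`. Only their values from
time `n` on are imposed, so each nonempty piece is a tail cylinder. -/
theorem measurableSet_tailAlgebra_level [G.LocallyFinite] {n i : ℕ} (hi : n ≤ i)
    (s : Set (Level G v₀ i)) : MeasurableSet[tailAlgebra G v₀ n] {z | z.1 i ∈ s} := by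
  have : {z : Paths G v₀ | z.1 i ∈ s} = ⋃ p : ∀ k : Fin (i + 1), Level G v₀ k,
      ⋃ (_ : p ⟨i, by omega⟩ ∈ s), {z | ∀ k : Fin (i + 1), n ≤ k → z.1 k = p k} := by
    ext z
    simp only [Set.mem_ofPred_eq, Set.mem_iUnion, exists_prop]
    constructor
    · exact fun h => ⟨fun k => z.1 k, h, fun k _ => rfl⟩
    · rintro ⟨p, hp, h⟩
      rw [h ⟨i, by omega⟩ hi]
      exact hp
  rw [this]
  refine @MeasurableSet.iUnion _ _ (tailAlgebra G v₀ n) _ _ fun p =>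
    @MeasurableSet.iUnion _ _ (tailAlgebra G v₀ n) _ _ fun _ => ?_
  rcases Set.eq_empty_or_nonempty
    {z : Paths G v₀ | ∀ k : Fin (i + 1), n ≤ k → z.1 k = p k} with h | ⟨w, hw⟩
  · rw [h]
    exact @MeasurableSet.empty _ (tailAlgebra G v₀ n)
  · refine MeasurableSpace.measurableSet_generateFrom ⟨w, i, ?_⟩
    ext z
    constructor
    · intro hz k hk hki
      have hki' : k < i + 1 := by omega
      exact (hz ⟨k, hki'⟩ hk).trans (hw ⟨k, hki'⟩ hk).symm
    · intro hz k hk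
      exact (hz k hk (by omega)).trans (hw k hk)

theorem measurableSet_tailAlgebra_eventually [G.LocallyFinite] (n : ℕ) (A : Set V) :
    MeasurableSet[tailAlgebra G v₀ n] {w : Paths G v₀ | ∀ᶠ i in atTop, proj w i ∈ A} := by
  have : {w : Paths G v₀ | ∀ᶠ i in atTop, proj w i ∈ A} =
      ⋃ N, ⋂ i, ⋂ (_ : max N n ≤ i), {w | w.1 i ∈ {v : Level G v₀ i | v.1 ∈ A}} := by
    ext w
    simp only [Set.mem_ofPred_eq, Set.mem_iUnion, Set.mem_iInter, eventually_atTop]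
    constructor
    · rintro ⟨N, hN⟩
      exact ⟨N, fun i hi => hN i (le_trans (le_max_left _ _) hi)⟩
    · rintro ⟨N, hN⟩
      exact ⟨_, hN⟩
  rw [this]
  exact @MeasurableSet.iUnion _ _ (tailAlgebra G v₀ n) _ _ fun N =>
    @MeasurableSet.iInter _ _ (tailAlgebra G v₀ n) _ _ fun i =>
      @MeasurableSet.iInter _ _ (tailAlgebra G v₀ n) _ _ fun hi =>
        measurableSet_tailAlgebra_level (le_trans (le_max_right _ _) hi) _

theorem pathCylinder_eq_tailCylinder (w : Paths G v₀) (n : ℕ) :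
    pathCylinder w n = tailCylinder w 0 n := by
  ext z
  simp [pathCylinder, tailCylinder]

theorem measurableSet_pathCylinder (w : Paths G v₀) (n : ℕ) :
    MeasurableSet (pathCylinder w n) := by
  rw [pathCylinder_eq_tailCylinder]
  exact measurableSet_tailCylinder w 0 n

/-- Probability measures on the path space are determined by the finite paths. -/
theorem ext_of_pathCylinder [G.LocallyFinite] {μ ν : Measure (Paths G v₀)} [IsProbabilityMeasure μ]
    [IsProbabilityMeasure ν] (h : ∀ w n, μ (pathCylinder w n) = ν (pathCylinder w n)) :
    μ = ν := by
  refine ext_of_generate_finite {S | ∃ w m, S = tailCylinder w 0 m} (le_antisymm ?_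
    (tailAlgebra_le 0)) (isPiSystem_tailCylinder 0) ?_ (by simp)
  · have hm : @Measurable _ _ (tailAlgebra G v₀ 0) _
        (Subtype.val : Paths G v₀ → ∀ n, Level G v₀ n) := by
      rw [@measurable_pi_iff]
      exact fun i s _ => measurableSet_tailAlgebra_level (Nat.zero_le i) s
    exact hm.comap_le
  · rintro _ ⟨w, m, rfl⟩
    rw [← pathCylinder_eq_tailCylinder, h]

/-- The path that follows `w` until time `n` and `z` afterwards. -/
def splice (w z : Paths G v₀) (n : ℕ) (h : w.1 n = z.1 n) : Paths G v₀ :=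
  ⟨fun k => if k ≤ n then w.1 k else z.1 k, fun k => by
    beta_reduce
    rcases lt_trichotomy k n with hk | rfl | hk
    · rw [if_pos hk.le, if_pos (show k + 1 ≤ n from hk)]
      exact w.2 k
    · rw [if_pos le_rfl, if_neg (by omega), h]
      exact z.2 k
    · rw [if_neg (by omega), if_neg (by omega)]
      exact z.2 k⟩

theorem splice_apply_of_le {w z : Paths G v₀} {n : ℕ} (h : w.1 n = z.1 n) {k : ℕ} (hk : k ≤ n) :
    (splice w z n h).1 k = w.1 k := if_pos hk

theorem splice_apply_of_ge {w z : Paths G v₀} {n : ℕ} (h : w.1 n = z.1 n) {k : ℕ} (hk : n ≤ k) :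
    (splice w z n h).1 k = z.1 k := by
  rcases hk.eq_or_lt with rfl | hk
  · rw [splice_apply_of_le h le_rfl, h]
  · exact if_neg (by omega)

theorem tailCylinder_inter_pathCylinder {w w₀ z : Paths G v₀} {n m : ℕ} (hnm : n ≤ m)
    (h : z ∈ tailCylinder w₀ n m) (h' : z ∈ pathCylinder w n) :
    tailCylinder w₀ n m ∩ pathCylinder w n = pathCylinder z m := by
  ext y
  constructor
  · rintro ⟨h1, h2⟩ k hk
    rcases le_total k n with hkn | hkn
    · exact (h2 k hkn).trans (h' k hkn).symm
    · exact (h1 k hkn hk).trans (h k hkn hk).symm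
  · exact fun hy => ⟨fun k h1 h2 => (hy k h2).trans (h k h1 h2),
      fun k hk => (hy k (by omega)).trans (h' k hk)⟩

/-- For a central measure, the initial segments of a path and its tail from level `n` on are
conditionally independent given the vertex of level `n`. -/
theorem IsCentral.measure_inter_pathCylinder {μ : Measure (Paths G v₀)} (hμ : IsCentral μ)
    {w w' : Paths G v₀} {n : ℕ} (hw : w.1 n = w'.1 n) {E : Set (Paths G v₀)}
    (hE : MeasurableSet[tailAlgebra G v₀ n] E) :
    μ (E ∩ pathCylinder w n) = μ (E ∩ pathCylinder w' n) := by
  have := hμ.prob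
  have hE' := tailAlgebra_le n _ hE
  rw [← Measure.restrict_apply hE', ← Measure.restrict_apply hE']
  refine ext_on_measurableSpace_of_generate_finite _ {S | ∃ w m, S = tailCylinder w n m} ?_
    (tailAlgebra_le n) rfl (isPiSystem_tailCylinder n) (by simpa using hμ.uniform n w w' hw) hE
  rintro _ ⟨w₀, m, rfl⟩
  have hm := measurableSet_tailCylinder w₀ n m
  rw [Measure.restrict_apply hm, Measure.restrict_apply hm]
  rcases lt_or_ge m n with hmn | hmn
  · have : tailCylinder w₀ n m = Set.univ := Set.eq_univ_of_forall fun z k h1 h2 => by omega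
    rw [this, Set.univ_inter, Set.univ_inter]
    exact hμ.uniform n w w' hw
  -- Replacing the initial segment of `z` by that of `w'` keeps the tail and the vertex of level
  -- `m`, so centrality at level `m` compares the two intersections, each of which is empty or a
  -- path cylinder.
  · have key : ∀ {w w' : Paths G v₀}, w.1 n = w'.1 n → ∀ z ∈ tailCylinder w₀ n m,
        z ∈ pathCylinder w n → ∃ z' ∈ tailCylinder w₀ n m,
          z' ∈ pathCylinder w' n ∧ z.1 m = z'.1 m := by
      intro w w' hw z hz hz'
      have h : w'.1 n = z.1 n := hw.symm.trans (hz' n le_rfl).symm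
      exact ⟨splice w' z n h, fun k h1 h2 => (splice_apply_of_ge h h1).trans (hz k h1 h2),
        fun k hk => splice_apply_of_le h hk, (splice_apply_of_ge h hmn).symm⟩
    rcases Set.eq_empty_or_nonempty (tailCylinder w₀ n m ∩ pathCylinder w n) with h | ⟨z, hz, hz'⟩
    · have h' : tailCylinder w₀ n m ∩ pathCylinder w' n = ∅ := by
        rw [Set.eq_empty_iff_forall_notMem]
        rintro z ⟨hz, hz'⟩
        obtain ⟨z', h1, h2, -⟩ := key hw.symm z hz hz'
        exact (Set.eq_empty_iff_forall_notMem.1 h) z' ⟨h1, h2⟩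
      rw [h, h']
    · obtain ⟨z', h1, h2, h3⟩ := key hw z hz hz'
      rw [tailCylinder_inter_pathCylinder hmn hz hz', tailCylinder_inter_pathCylinder hmn h1 h2]
      exact hμ.uniform m z z' h3

/-- For every `n` the tail event meets the cylinders of finite paths with a common endpoint of level
`n` in equal mass, and normalization does not affect this. -/
theorem IsCentral.cond {μ : Measure (Paths G v₀)} (hμ : IsCentral μ) {E : Set (Paths G v₀)}
    (hE : ∀ n, MeasurableSet[tailAlgebra G v₀ n] E) (h0 : μ E ≠ 0) : IsCentral μ[|E] := by
  have := hμ.prob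
  refine ⟨cond_isProbabilityMeasure h0, fun n w w' hw => ?_⟩
  have hE' := tailAlgebra_le n _ (hE n)
  rw [cond_apply hE', cond_apply hE', hμ.measure_inter_pathCylinder hw (hE n)]

/-- Tail events have probability zero or one with respect to an ergodic central measure. -/
theorem IsErgodic.measure_eq_zero_or {μ : Measure (Paths G v₀)} (hμ : IsErgodic μ)
    {E : Set (Paths G v₀)} (hE : ∀ n, MeasurableSet[tailAlgebra G v₀ n] E) :
    μ E = 0 ∨ μ Eᶜ = 0 := by
  by_contra! hne
  have hc : IsCentral μ := hμ.1
  have := hc.prob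
  have hEm := tailAlgebra_le 0 _ (hE 0)
  have hEc : ∀ n, MeasurableSet[tailAlgebra G v₀ n] Eᶜ := fun n =>
    @MeasurableSet.compl _ _ (tailAlgebra G v₀ n) (hE n)
  have h1 := hc.cond hE hne.1
  have h2 := hc.cond hEc hne.2
  -- Total probability: `μ` is the mean of its conditional measures with weights `μ E` and `μ Eᶜ`.
  have hseg : μ ∈ openSegment ℝ≥0 μ[|E] μ[|Eᶜ] := by
    refine ⟨(μ E).toNNReal, (μ Eᶜ).toNNReal, ?_, ?_, ?_, ?_⟩
    · exact ENNReal.toNNReal_pos hne.1 (measure_ne_top _ _)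
    · exact ENNReal.toNNReal_pos hne.2 (measure_ne_top _ _)
    · rw [← ENNReal.toNNReal_add (measure_ne_top _ _) (measure_ne_top _ _),
        measure_add_measure_compl hEm, measure_univ, ENNReal.toNNReal_one]
    · refine Measure.ext fun s hs => ?_
      rw [Measure.add_apply, Measure.smul_apply, Measure.smul_apply, cond_apply hEm,
        cond_apply hEm.compl, ENNReal.smul_def, ENNReal.smul_def,
        ENNReal.coe_toNNReal (measure_ne_top _ _), ENNReal.coe_toNNReal (measure_ne_top _ _),
        smul_eq_mul, smul_eq_mul, ← mul_assoc, ← mul_assoc,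
        ENNReal.mul_inv_cancel hne.1 (measure_ne_top _ _),
        ENNReal.mul_inv_cancel hne.2 (measure_ne_top _ _), one_mul, one_mul,
        Set.inter_comm, Set.inter_comm Eᶜ, ← Set.sdiff_eq, measure_inter_add_sdiff s hEm]
  have h3 := (mem_extremePoints.1 hμ).2 _ h1 _ h2 hseg
  apply hne.2
  rw [← h3.1, cond_apply hEm, Set.inter_compl_self, measure_empty, mul_zero]

end Tail

/-! ### Centrality, and failure of ergodicity for r < 1/2. -/

section Central

variable {V : Type u} {G : SimpleGraph V} [G.LocallyFinite] {q : ℕ}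
  (hG : IsHomogeneousTree G q) (hq : 2 ≤ q) (v₀ : V) (ω : Ends G) (r : unitInterval)

-- Here `a` and `c` count the up-steps and the down-steps. The first two equations determine them
-- from the level and the height of the last vertex, so the weight depends on the endpoint alone.
omit [G.LocallyFinite] in
theorem exists_prod_transProb_eq (hG : G.IsTree) (q : ℕ) (w : Paths G v₀) (n : ℕ) :
    ∃ a c : ℕ, a + c = n ∧ (a : ℤ) - c = height hG ω v₀ (proj w n) ∧
      ∏ k ∈ Finset.range n, (transProb q ω r (proj w k) (proj w (k + 1))).toReal =
        (r : ℝ) ^ a * ((1 - r) / q) ^ c := by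
  induction n with
  | zero => exact ⟨0, 0, rfl, by simp [proj, (w.1 0).eq_base], by simp⟩
  | succ n ih =>
    obtain ⟨a, c, hac, hh, hp⟩ := ih
    have hpos : (0 : ℝ) ≤ (1 - r) / q := div_nonneg (by linarith [r.2.2]) (by positivity)
    rw [Finset.prod_range_succ, hp]
    rcases eq_up_or_up_eq hG ω (w.2 n) with h | h
    · refine ⟨a + 1, c, by omega, ?_, ?_⟩
      · change _ = height hG ω v₀ (w.1 (n + 1)).1
        rw [h, height_up]
        push_cast
        have : height hG ω v₀ (w.1 n).1 = height hG ω v₀ (proj w n) := rfl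
        omega
      · have : proj w (n + 1) = up hG ω (proj w n) := h
        rw [this, transProb_up, ENNReal.toReal_ofReal r.2.1]
        ring
    · have h' : up hG ω (proj w (n + 1)) = proj w n := h
      refine ⟨a, c + 1, by omega, ?_, ?_⟩
      · rw [← h', height_up] at hh
        push_cast
        omega
      · rw [transProb_child hG ω r h', ENNReal.toReal_ofReal hpos]
        ring

theorem isCentral_markovMeasure : IsCentral (markovMeasure hG hq v₀ ω r) := by
  refine ⟨inferInstance, fun n w w' h => ?_⟩
  rw [← ENNReal.toReal_eq_toReal_iff' (measure_ne_top _ _) (measure_ne_top _ _)]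
  change (markovMeasure hG hq v₀ ω r).real _ = (markovMeasure hG hq v₀ ω r).real _
  rw [measureReal_pathCylinder, measureReal_pathCylinder]
  obtain ⟨a, c, h1, h2, h3⟩ := exists_prod_transProb_eq v₀ ω r hG.isTree q w n
  obtain ⟨a', c', h1', h2', h3'⟩ := exists_prod_transProb_eq v₀ ω r hG.isTree q w' n
  have : proj w n = proj w' n := congrArg Subtype.val h
  rw [this] at h2
  obtain rfl : a = a' := by omega
  obtain rfl : c = c' := by omega
  rw [h3, h3']

/-- Ergodicity makes each tail event `E a b` trivial. There are countably many of them and they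
determine the limit end, which is therefore almost surely constant, although its law has no atoms.
-/
theorem not_isErgodic_markovMeasure (hr : (r : ℝ) < 1 / 2) :
    ¬ IsErgodic (markovMeasure hG hq v₀ ω r) := by
  intro herg
  have := countable_vertices hG.isTree
  set μ := markovMeasure hG hq v₀ ω r with hμ
  let E : V → V → Set (Paths G v₀) := fun a b =>
    {w | ∀ᶠ i in atTop, proj w i ∈ {x | G.dist x b < G.dist x a}}
  have h01 : ∀ a b, ∀ᵐ w ∂μ, (w ∈ E a b ↔ μ (E a b) ≠ 0) := by
    intro a b
    rcases herg.measure_eq_zero_or fun n => measurableSet_tailAlgebra_eventually n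
      {x | G.dist x b < G.dist x a} with h | h
    · filter_upwards [measure_eq_zero_iff_ae_notMem.1 h] with w hw
      exact ⟨fun h' => absurd h' hw, fun h' => absurd h h'⟩
    · have h' : μ (E a b) ≠ 0 := by
        intro h0
        have h1 := measure_univ_le_add_compl (μ := μ) (E a b)
        rw [measure_univ, h0, show μ (E a b)ᶜ = 0 from h, add_zero] at h1
        exact absurd h1 (by simp)
      filter_upwards [measure_eq_zero_iff_ae_notMem.1 h] with w hw
      exact ⟨fun _ => h', fun _ => not_not.1 hw⟩
  have hall : ∀ᵐ w ∂μ, (∀ a b, w ∈ E a b ↔ μ (E a b) ≠ 0) ∧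
      Tendsto (fun n => height hG.isTree ω v₀ (proj w n)) atTop atBot :=
    (ae_all_iff.2 fun a => ae_all_iff.2 fun b => h01 a b).and (ae_tendsto_height_proj_atBot hG hq v₀ ω r hr)
  obtain ⟨w', hw', hgood'⟩ := hall.exists
  have hae : ∀ᵐ w ∂μ, limitEnd hG v₀ ω w = limitEnd hG v₀ ω w' := by
    filter_upwards [hall] with w hw
    refine Ends.ext_directed hG.isTree v₀ fun a b hab => ?_
    rw [(limitEnd_spec hG hw.2).2.2] at hab
    rw [(limitEnd_spec hG hgood').2.2]
    exact ⟨hab.1, (hw' a b).2 ((hw.1 a b).1 hab.2)⟩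
  have h0 := map_limitEnd_singleton hG hq v₀ ω r hr (limitEnd hG v₀ ω w')
  have h1 := ae_of_ae_map (measurable_limitEnd hG v₀ ω).aemeasurable
    (measure_eq_zero_iff_ae_notMem.1 h0)
  obtain ⟨w, hw, hw2⟩ := (hae.and h1).exists
  exact hw2 hw

end Central

/-! ### One-dimensional Liouville properties. -/

/-- A bounded sequence of nonnegative numbers with `s 0 = 0` that is subharmonic for a random walk
on `ℕ` with drift towards `0` vanishes. -/
theorem eq_zero_of_subharmonic {s : ℕ → ℝ} {C r : ℝ} (hr : 1 / 2 ≤ r) (hr1 : r < 1)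
    (h0 : s 0 = 0) (hs : ∀ n, 0 ≤ s n) (hC : ∀ n, s n ≤ C)
    (hsub : ∀ n, s (n + 1) ≤ r * s n + (1 - r) * s (n + 2)) (n : ℕ) : s n = 0 := by
  -- Subharmonicity says that `r` times an increment is at most `1 - r` times the next one, and r ≥
  -- 1 - r. A positive increment would thus persist and contradict boundedness.
  have hd : ∀ n, 0 ≤ s (n + 1) - s n → s (n + 1) - s n ≤ s (n + 2) - s (n + 1) := by
    intro n hn
    have := hsub n
    nlinarith
  have hanti : ∀ n, s (n + 1) ≤ s n := by
    intro n
    by_contra! hlt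
    have hgrow : ∀ m : ℕ, s (n + 1) - s n ≤ s (n + m + 1) - s (n + m) := by
      intro m
      induction m with
      | zero => simp
      | succ m ih =>
        have := hd (n + m) (by linarith)
        have h1 : s (n + (m + 1) + 1) = s (n + m + 2) := rfl
        have h2 : s (n + (m + 1)) = s (n + m + 1) := rfl
        rw [h1, h2]
        linarith
    have hlin : ∀ m : ℕ, s n + m * (s (n + 1) - s n) ≤ s (n + m) := by
      intro m
      induction m with
      | zero => simp
      | succ m ih =>
        have := hgrow m
        rw [← Nat.add_assoc]
        push_cast
        linarith
    obtain ⟨m, hm⟩ := exists_nat_gt (C / (s (n + 1) - s n))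
    rw [div_lt_iff₀ (by linarith)] at hm
    have := hlin m
    have := hC (n + m)
    have := hs n
    linarith
  induction n with
  | zero => exact h0
  | succ n ih => exact le_antisymm (ih ▸ hanti n) (hs _)

section RandomWalk

variable {D : ℕ → ℤ → Prop} {g : ℕ → ℤ → ℝ} {C r : ℝ}

/-- The difference g n (k + 2) - g n k is again a weighted mean of two such differences one step
later. If their supremum `M` is positive, a difference close enough to `M` forces `j + 1`
consecutive differences to be at least `M / 2` after `j` steps. These telescope to more than `2 * C`
once `j > 4 * C / M`. -/
theorem sub_nonpos_of_parabolic (hr0 : 0 < r) (hr1 : r < 1)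
    (hup : ∀ n k, D n k → D (n + 1) (k + 1)) (hdown : ∀ n k, D n k → D (n + 1) (k - 1))
    (hC : ∀ n k, D n k → |g n k| ≤ C)
    (hg : ∀ n k, D n k → g n k = r * g (n + 1) (k + 1) + (1 - r) * g (n + 1) (k - 1))
    {n : ℕ} {k : ℤ} (hk : D n k) (hk2 : D n (k + 2)) : g n (k + 2) - g n k ≤ 0 := by
  set S : Set ℝ := {t | ∃ n k, D n k ∧ D n (k + 2) ∧ t = g n (k + 2) - g n k} with hS
  have hbdd : BddAbove S := by
    refine ⟨2 * C, ?_⟩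
    rintro _ ⟨n, k, h1, h2, rfl⟩
    have := abs_le.1 (hC _ _ h1)
    have := abs_le.1 (hC _ _ h2)
    linarith
  have hle : ∀ n k, D n k → D n (k + 2) → g n (k + 2) - g n k ≤ sSup S :=
    fun n k h1 h2 => le_csSup hbdd ⟨n, k, h1, h2, rfl⟩
  refine (hle n k hk hk2).trans ?_
  set M := sSup S with hM
  by_contra! hpos
  obtain ⟨j, hj⟩ := exists_nat_gt (4 * C / M)
  rw [div_lt_iff₀ hpos] at hj
  -- One step multiplies the deficit from `M` by at most `1 / c`, so an initial deficit below `c ^ j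
  -- * (M / 2)` stays at most `M / 2` for `j` steps.
  set c := min r (1 - r) with hc
  have hc0 : 0 < c := lt_min hr0 (by linarith)
  have hcr : c ≤ r := min_le_left _ _
  have hcr' : c ≤ 1 - r := min_le_right _ _
  obtain ⟨_, ⟨n, k, h1, h2, rfl⟩, hlt⟩ := exists_lt_of_lt_csSup (s := S) (b := M - c ^ j * (M / 2))
    ⟨_, n, k, hk, hk2, rfl⟩ (by
      rw [← hM]
      have : 0 < c ^ j * (M / 2) := by positivity
      linarith)
  have hnear : ∀ i : ℕ, ∀ l : ℕ, l ≤ i → D (n + i) (k - i + 2 * l) ∧ D (n + i) (k - i + 2 * l + 2) ∧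
      c ^ i * (M - (g (n + i) (k - i + 2 * l + 2) - g (n + i) (k - i + 2 * l))) ≤
        c ^ j * (M / 2) := by
    intro i
    induction i with
    | zero =>
      intro l hl
      obtain rfl : l = 0 := by omega
      simp only [Nat.cast_zero, sub_zero, mul_zero, add_zero, pow_zero, one_mul]
      exact ⟨h1, h2, by linarith⟩
    | succ i ih =>
      have main : ∀ m : ℤ, D (n + i) m → D (n + i) (m + 2) →
          c ^ i * (M - (g (n + i) (m + 2) - g (n + i) m)) ≤ c ^ j * (M / 2) →
          (c ^ (i + 1) * (M - (g (n + i + 1) (m + 1 + 2) - g (n + i + 1) (m + 1))) ≤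
            c ^ j * (M / 2)) ∧
          (c ^ (i + 1) * (M - (g (n + i + 1) (m - 1 + 2) - g (n + i + 1) (m - 1))) ≤
            c ^ j * (M / 2)) := by
        intro m hm hm2 hle'
        have e1 := hg _ _ hm
        have e2 := hg _ _ hm2
        have b1 := hle (n + i + 1) (m + 1) (hup _ _ hm) (by
          have := hup _ _ hm2
          rwa [show m + 2 + 1 = m + 1 + 2 by ring] at this)
        have b2 := hle (n + i + 1) (m - 1) (hdown _ _ hm) (by
          have := hdown _ _ hm2
          rwa [show m + 2 - 1 = m - 1 + 2 by ring] at this)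
        rw [show m + 2 + 1 = m + 1 + 2 by ring, show m + 2 - 1 = m - 1 + 2 by ring] at e2
        set A := M - (g (n + i + 1) (m + 1 + 2) - g (n + i + 1) (m + 1)) with hA
        set B := M - (g (n + i + 1) (m - 1 + 2) - g (n + i + 1) (m - 1)) with hB
        have hA0 : 0 ≤ A := by linarith
        have hB0 : 0 ≤ B := by linarith
        have hsum : M - (g (n + i) (m + 2) - g (n + i) m) = r * A + (1 - r) * B := by
          rw [e1, e2, hA, hB]
          ring
        rw [hsum] at hle'
        have hci : 0 ≤ c ^ i := by positivity
        have hr1' : 0 ≤ (1 - r) := by linarith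
        constructor
        · refine le_trans ?_ hle'
          rw [pow_succ, mul_assoc]
          refine mul_le_mul_of_nonneg_left ?_ hci
          have := mul_le_mul_of_nonneg_right hcr hA0
          have := mul_nonneg hr1' hB0
          linarith
        · refine le_trans ?_ hle'
          rw [pow_succ, mul_assoc]
          refine mul_le_mul_of_nonneg_left ?_ hci
          have := mul_le_mul_of_nonneg_right hcr' hB0
          have := mul_nonneg hr0.le hA0
          linarith
      intro l hl
      cases l with
      | zero =>
        obtain ⟨d1, d2, hle'⟩ := ih 0 (Nat.zero_le _)
        have h := (main _ d1 d2 hle').2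
        have e : k - ((i + 1 : ℕ) : ℤ) + 2 * ((0 : ℕ) : ℤ) = k - i + 2 * ((0 : ℕ) : ℤ) - 1 := by
          push_cast
          ring
        rw [e]
        refine ⟨hdown _ _ d1, ?_, h⟩
        have := hdown _ _ d2
        rwa [show k - (i : ℤ) + 2 * ((0 : ℕ) : ℤ) + 2 - 1 = k - i + 2 * ((0 : ℕ) : ℤ) - 1 + 2 by
          ring] at this
      | succ l =>
        obtain ⟨d1, d2, hle'⟩ := ih l (by omega)
        have h := (main _ d1 d2 hle').1
        have e : k - ((i + 1 : ℕ) : ℤ) + 2 * ((l + 1 : ℕ) : ℤ) = k - i + 2 * (l : ℤ) + 1 := by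
          push_cast
          ring
        rw [e]
        refine ⟨hup _ _ d1, ?_, h⟩
        have := hup _ _ d2
        rwa [show k - (i : ℤ) + 2 * (l : ℤ) + 2 + 1 = k - i + 2 * (l : ℤ) + 1 + 2 by ring] at this
  have hhalf : ∀ l ≤ j, M / 2 ≤ g (n + j) (k - j + 2 * l + 2) - g (n + j) (k - j + 2 * l) := by
    intro l hl
    have := le_of_mul_le_mul_left (hnear j l hl).2.2 (by positivity)
    linarith
  have hchain : ∀ l : ℕ, l ≤ j + 1 →
      g (n + j) (k - j) + l * (M / 2) ≤ g (n + j) (k - j + 2 * l) := by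
    intro l
    induction l with
    | zero => simp
    | succ l ih =>
      intro hl
      have h3 := ih (by omega)
      have h4 := hhalf l (by omega)
      rw [show k - (j : ℤ) + 2 * ((l + 1 : ℕ) : ℤ) = k - j + 2 * l + 2 by
        push_cast
        ring]
      push_cast
      linarith
  have h5 := hchain (j + 1) le_rfl
  have h6 := hnear j 0 (Nat.zero_le _)
  have h7 := hnear j j le_rfl
  have b1 := abs_le.1 (hC _ _ h6.1)
  have b2 := abs_le.1 (hC _ _ h7.2.1)
  rw [show k - (j : ℤ) + 2 * ((0 : ℕ) : ℤ) = k - j by simp] at b1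
  rw [show k - (j : ℤ) + 2 * ((j + 1 : ℕ) : ℤ) = k - j + 2 * (j : ℤ) + 2 by
    push_cast
    ring] at h5
  push_cast at h5
  linarith

/-- Bounded space-time harmonic functions of a nearest neighbour random walk on `ℤ` are
constant along its paths. -/
theorem eq_of_parabolic (hr0 : 0 < r) (hr1 : r < 1)
    (hup : ∀ n k, D n k → D (n + 1) (k + 1)) (hdown : ∀ n k, D n k → D (n + 1) (k - 1))
    (hC : ∀ n k, D n k → |g n k| ≤ C)
    (hg : ∀ n k, D n k → g n k = r * g (n + 1) (k + 1) + (1 - r) * g (n + 1) (k - 1))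
    {n : ℕ} {k : ℤ} (hk : D n k) :
    g (n + 1) (k + 1) = g n k ∧ g (n + 1) (k - 1) = g n k := by
  have hu := hup _ _ hk
  have hd := hdown _ _ hk
  have hu' : D (n + 1) (k - 1 + 2) := by rwa [show k - 1 + 2 = k + 1 by ring]
  have h1 := sub_nonpos_of_parabolic hr0 hr1 hup hdown hC hg hd hu'
  have h2 := sub_nonpos_of_parabolic (g := fun n k => -g n k) hr0 hr1 hup hdown
    (fun n k h => by rw [abs_neg]; exact hC n k h) (fun n k h => by rw [hg n k h]; ring) hd hu'
  rw [show k - 1 + 2 = k + 1 by ring] at h1 h2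
  have h3 := hg _ _ hk
  have h4 : g (n + 1) (k + 1) = g (n + 1) (k - 1) := by linarith
  rw [h4] at h3 ⊢
  constructor <;> linarith

end RandomWalk

/-! ### Bounded space-time harmonic functions on the tree. -/

section Parabolic

variable {V : Type u} {G : SimpleGraph V} [G.LocallyFinite] {q : ℕ}
  (hG : IsHomogeneousTree G q) (hq : 2 ≤ q) (v₀ : V) (ω : Ends G) (r : unitInterval)

include hq

theorem exists_mem_children (x : V) : ∃ y, y ∈ children hG.isTree ω x := by
  have : (children hG.isTree ω x).Nonempty := by
    rw [← Finset.card_pos, card_children hG]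
    omega
  exact this

variable {v₀ ω r}

/-- A bounded space-time harmonic function of a chain with nonnegative drift towards `ω` depends on a
vertex only through its height. -/
theorem eq_of_iterate_up_eq (hr : (1 / 2 : ℝ) ≤ r) (hr1 : (r : ℝ) < 1) {h : ℕ → V → ℝ} {C : ℝ}
    (hC : ∀ n x, x ∈ levelSet G v₀ n → |h n x| ≤ C)
    (hh : ∀ n x, x ∈ levelSet G v₀ n → h n x = transMean hG.isTree q ω r (h (n + 1)) x)
    {n : ℕ} {x y : V} (hx : x ∈ levelSet G v₀ n) (hy : y ∈ levelSet G v₀ n) {L : ℕ}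
    (hxy : (up hG.isTree ω)^[L] x = (up hG.isTree ω)^[L] y) : h n x = h n y := by
  -- The supremum of `S L` is the largest oscillation between vertices of one level whose rays to
  -- `ω` have merged after `L` parent steps. Two coupled chains move to their parents, lowering `L`
  -- by one, or to matched children, raising it by one; so this supremum is subharmonic for a walk
  -- on ℕ.
  set S : ℕ → Set ℝ := fun L => {t | ∃ n x y, x ∈ levelSet G v₀ n ∧ y ∈ levelSet G v₀ n ∧
    (up hG.isTree ω)^[L] x = (up hG.isTree ω)^[L] y ∧ t = |h n x - h n y|} with hS
  have hv₀ : v₀ ∈ levelSet G v₀ 0 := (root G v₀).2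
  have hmem : ∀ L, (0 : ℝ) ∈ S L := fun L => ⟨0, v₀, v₀, hv₀, hv₀, rfl, by simp⟩
  have hub : ∀ L, ∀ t ∈ S L, t ≤ 2 * C := by
    rintro L _ ⟨n, x, y, hx, hy, -, rfl⟩
    have := abs_sub (h n x) (h n y)
    have := hC n x hx
    have := hC n y hy
    linarith
  have hle : ∀ {n L x y}, x ∈ levelSet G v₀ n → y ∈ levelSet G v₀ n →
      (up hG.isTree ω)^[L] x = (up hG.isTree ω)^[L] y → |h n x - h n y| ≤ sSup (S L) :=
    fun hx hy hxy => le_csSup ⟨_, hub _⟩ ⟨_, _, _, hx, hy, hxy, rfl⟩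
  have hr0 : (0 : ℝ) ≤ 1 - r := by linarith
  have hq0 : (0 : ℝ) < q := by positivity
  have hzero := eq_zero_of_subharmonic (s := fun L => sSup (S L)) (C := 2 * C) hr hr1 ?_
    (fun L => le_csSup ⟨_, hub L⟩ (hmem L)) (fun L => csSup_le ⟨_, hmem L⟩ (hub L)) ?_ L
  · have h1 := hle hx hy hxy
    have h2 : sSup (S L) = 0 := hzero
    rw [h2] at h1
    exact sub_eq_zero.1 (abs_nonpos_iff.1 h1)
  · refine le_antisymm (csSup_le ⟨_, hmem 0⟩ ?_) (le_csSup ⟨_, hub 0⟩ (hmem 0))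
    rintro _ ⟨n, x, y, -, -, hxy, rfl⟩
    obtain rfl : x = y := hxy
    simp
  · intro L
    refine csSup_le ⟨_, hmem _⟩ ?_
    rintro _ ⟨n, x, y, hx, hy, hxy, rfl⟩
    rw [hh n x hx, hh n y hy, transMean, transMean]
    have hup := hle (mem_levelSet_succ_of_adj hx (adj_up hG.isTree ω x))
      (mem_levelSet_succ_of_adj hy (adj_up hG.isTree ω y)) (L := L) (by
        rw [← Function.iterate_succ_apply, ← Function.iterate_succ_apply, hxy])
    -- Any bijection of the children serves: the rays of two matched children merge after `L + 2`
    -- parent steps.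
    let e := Finset.equivOfCardEq ((card_children hG ω x).trans (card_children hG ω y).symm)
    have hsum : |∑ a ∈ children hG.isTree ω x, h (n + 1) a -
        ∑ b ∈ children hG.isTree ω y, h (n + 1) b| ≤ q * sSup (S (L + 2)) := by
      have h1 : ∑ b ∈ children hG.isTree ω y, h (n + 1) b =
          ∑ a : children hG.isTree ω x, h (n + 1) (e a) := by
        rw [← Finset.sum_coe_sort, ← e.sum_comp]
      rw [h1, ← Finset.sum_coe_sort, ← Finset.sum_sub_distrib]
      refine (Finset.abs_sum_le_sum_abs _ _).trans ?_
      have hterm : ∀ a : children hG.isTree ω x,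
          |h (n + 1) a - h (n + 1) (e a)| ≤ sSup (S (L + 2)) := by
        intro a
        have ha := up_of_mem_children a.2
        have hb := up_of_mem_children (e a).2
        refine hle (mem_levelSet_succ_of_adj hx ?_) (mem_levelSet_succ_of_adj hy ?_) ?_
        · have := (adj_up hG.isTree ω a.1).symm
          rwa [ha] at this
        · have := (adj_up hG.isTree ω (e a).1).symm
          rwa [hb] at this
        · rw [Function.iterate_succ_apply, Function.iterate_succ_apply _ _ (e a).1, ha, hb, hxy]
      refine (Finset.sum_le_sum fun a _ => hterm a).trans ?_
      rw [Finset.sum_const, Finset.card_univ, Fintype.card_coe, card_children hG, nsmul_eq_mul]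
    have hc : 0 ≤ (1 - r : ℝ) / q := by positivity
    calc |r * h (n + 1) (up hG.isTree ω x) + (1 - r : ℝ) / q * ∑ a ∈ children hG.isTree ω x, h (n + 1) a
          - (r * h (n + 1) (up hG.isTree ω y) +
            (1 - r : ℝ) / q * ∑ b ∈ children hG.isTree ω y, h (n + 1) b)|
        = |r * (h (n + 1) (up hG.isTree ω x) - h (n + 1) (up hG.isTree ω y)) +
            (1 - r : ℝ) / q * (∑ a ∈ children hG.isTree ω x, h (n + 1) a -
              ∑ b ∈ children hG.isTree ω y, h (n + 1) b)| := by
          congr 1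
          ring
      _ ≤ |r * (h (n + 1) (up hG.isTree ω x) - h (n + 1) (up hG.isTree ω y))| +
            |(1 - r : ℝ) / q * (∑ a ∈ children hG.isTree ω x, h (n + 1) a -
              ∑ b ∈ children hG.isTree ω y, h (n + 1) b)| := abs_add_le _ _
      _ ≤ r * sSup (S L) + (1 - r : ℝ) / q * (q * sSup (S (L + 2))) := by
          rw [abs_mul, abs_mul, abs_of_nonneg r.2.1, abs_of_nonneg hc]
          exact add_le_add (mul_le_mul_of_nonneg_left hup r.2.1)
            (mul_le_mul_of_nonneg_left hsum hc)
      _ = r * sSup (S L) + (1 - r) * sSup (S (L + 2)) := by field_simp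

/-- Bounded space-time harmonic functions of a chain with nonnegative drift towards `ω` are
constant. -/
theorem eq_of_adj_of_parabolic (hr : (1 / 2 : ℝ) ≤ r) (hr1 : (r : ℝ) < 1) {h : ℕ → V → ℝ} {C : ℝ}
    (hC : ∀ n x, x ∈ levelSet G v₀ n → |h n x| ≤ C)
    (hh : ∀ n x, x ∈ levelSet G v₀ n → h n x = transMean hG.isTree q ω r (h (n + 1)) x)
    {n : ℕ} {x y : V} (hx : x ∈ levelSet G v₀ n) (hxy : G.Adj x y) : h (n + 1) y = h n x := by
  classical
  have hheight : ∀ {n x y}, x ∈ levelSet G v₀ n → y ∈ levelSet G v₀ n →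
      height hG.isTree ω v₀ x = height hG.isTree ω v₀ y → h n x = h n y := by
    intro n x y hx hy hxy
    obtain ⟨a, b, hab⟩ := exists_iterate_up_eq hG.isTree ω x y
    have := congrArg (height hG.isTree ω v₀) hab
    rw [height_iterate_up, height_iterate_up, hxy] at this
    obtain rfl : a = b := by omega
    exact eq_of_iterate_up_eq hG hq hr hr1 hC hh hx hy hab
  set D : ℕ → ℤ → Prop := fun n k => ∃ x ∈ levelSet G v₀ n, height hG.isTree ω v₀ x = k with hD
  -- By `hheight` the chosen vertex does not matter. The value 0 outside `D` plays no role, because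
  -- `D` is closed under the steps of the walk.
  set g : ℕ → ℤ → ℝ := fun n k => if h' : D n k then h n h'.choose else 0 with hg
  have hgh : ∀ {n x}, x ∈ levelSet G v₀ n → g n (height hG.isTree ω v₀ x) = h n x := by
    intro n x hx
    have h' : D n (height hG.isTree ω v₀ x) := ⟨x, hx, rfl⟩
    simp only [hg]
    rw [dif_pos h']
    exact hheight h'.choose_spec.1 hx h'.choose_spec.2
  have hlu : ∀ {n x}, x ∈ levelSet G v₀ n → up hG.isTree ω x ∈ levelSet G v₀ (n + 1) :=
    fun hx => mem_levelSet_succ_of_adj hx (adj_up hG.isTree ω _)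
  have hlc : ∀ {n x y}, x ∈ levelSet G v₀ n → up hG.isTree ω y = x →
      y ∈ levelSet G v₀ (n + 1) ∧
        height hG.isTree ω v₀ y = height hG.isTree ω v₀ x - 1 := by
    rintro n x y hx rfl
    exact ⟨mem_levelSet_succ_of_adj hx (adj_up hG.isTree ω y).symm, by rw [height_up]; ring⟩
  have key := fun n k hk => eq_of_parabolic (D := D) (g := g) (C := C) (r := r) (n := n) (k := k)
    (by linarith) hr1 ?_ ?_ ?_ ?_ hk
  · obtain ⟨h1, h2⟩ := key n _ ⟨x, hx, rfl⟩
    rcases eq_up_or_up_eq hG.isTree ω hxy with rfl | h'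
    · rw [← height_up hG.isTree, hgh (hlu hx), hgh hx] at h1
      exact h1
    · obtain ⟨hy, hhy⟩ := hlc hx h'
      rw [← hhy, hgh hy, hgh hx] at h2
      exact h2
  · rintro n _ ⟨x, hx, rfl⟩
    exact ⟨up hG.isTree ω x, hlu hx, height_up _ _ _ _⟩
  · rintro n _ ⟨x, hx, rfl⟩
    obtain ⟨y, hy⟩ := exists_mem_children hG hq ω x
    exact ⟨y, hlc hx (up_of_mem_children hy)⟩
  · rintro n _ ⟨x, hx, rfl⟩
    rw [hgh hx]
    exact hC n x hx
  · rintro n _ ⟨x, hx, rfl⟩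
    have hsum : ∀ y ∈ children hG.isTree ω x, h (n + 1) y =
        g (n + 1) (height hG.isTree ω v₀ x - 1) := by
      intro y hy
      obtain ⟨h1, h2⟩ := hlc hx (up_of_mem_children hy)
      rw [← h2, hgh h1]
    have hq0 : (q : ℝ) ≠ 0 := by positivity
    rw [hgh hx, hh n x hx, transMean, Finset.sum_congr rfl hsum, Finset.sum_const,
      card_children hG, ← height_up hG.isTree, hgh (hlu hx), nsmul_eq_mul]
    field_simp

end Parabolic

/-! ### Extensions of finite paths and densities of central measures. -/

section Extension

variable {V : Type u} {G : SimpleGraph V} {v₀ : V}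

/-- The infinite path with a given sequence of projections. -/
def pathOfSeq (f : ℕ → V) (h0 : f 0 = v₀) (hf : ∀ n, G.Adj (f n) (f (n + 1))) : Paths G v₀ :=
  ⟨fun n => ⟨f n, by
    induction n with
    | zero => exact h0 ▸ (root G v₀).2
    | succ n ih => exact mem_levelSet_succ_of_adj ih (hf n)⟩, hf⟩

/-- A finite path that ends at `x` can be continued to an infinite one. -/
theorem exists_path_of_seq (hG : G.IsTree) (ω : Ends G) (f : ℕ → V) (h0 : f 0 = v₀) (n : ℕ)
    (hf : ∀ k < n, G.Adj (f k) (f (k + 1))) : ∃ w : Paths G v₀, ∀ k ≤ n, proj w k = f k := by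
  let g : ℕ → V := fun k => if k ≤ n then f k else (up hG ω)^[k - n] (f n)
  refine ⟨pathOfSeq g (by simp [g, h0]) fun k => ?_, fun k hk => if_pos hk⟩
  simp only [g]
  rcases lt_trichotomy k n with hk | rfl | hk
  · rw [if_pos hk.le, if_pos (show k + 1 ≤ n from hk)]
    exact hf k hk
  · rw [if_pos le_rfl, if_neg (by omega), Nat.add_sub_cancel_left]
    exact adj_up hG ω _
  · rw [if_neg (by omega), if_neg (by omega), Nat.sub_add_comm hk.le, Function.iterate_succ_apply']
    exact adj_up hG ω _

theorem exists_path_proj_eq (hG : G.IsTree) (ω : Ends G) {n : ℕ} {x : V}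
    (hx : x ∈ levelSet G v₀ n) : ∃ w : Paths G v₀, proj w n = x := by
  obtain ⟨p, hp⟩ := hx
  obtain ⟨w, hw⟩ := exists_path_of_seq hG ω p.getVert p.getVert_zero n fun k hk =>
    p.adj_getVert_succ (by omega)
  refine ⟨w, ?_⟩
  rw [hw n le_rfl, ← hp, p.getVert_length]

theorem exists_extension (hG : G.IsTree) (ω : Ends G) (w : Paths G v₀) (n : ℕ) {y : V}
    (hy : G.Adj (proj w n) y) :
    ∃ w' : Paths G v₀, (∀ k ≤ n, w'.1 k = w.1 k) ∧ proj w' (n + 1) = y := by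
  obtain ⟨w', hw'⟩ := exists_path_of_seq (v₀ := v₀) hG ω (fun k => if k ≤ n then proj w k else y)
    (by simp [proj, (w.1 0).eq_base]) (n + 1) fun k hk => by
      rcases Nat.lt_succ_iff_lt_or_eq.1 hk with hk | rfl
      · rw [if_pos hk.le, if_pos (show k + 1 ≤ n from hk)]
        exact w.2 k
      · rw [if_pos le_rfl, if_neg (by omega)]
        exact hy
  refine ⟨w', fun k hk => Subtype.ext ?_, ?_⟩
  · exact (hw' k (by omega)).trans (if_pos hk)
  · exact (hw' (n + 1) le_rfl).trans (if_neg (by omega))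

/-- The probability of a finite path is the sum of the probabilities of its one-step extensions. -/
theorem measureReal_pathCylinder_eq_sum [G.LocallyFinite] (μ : Measure (Paths G v₀))
    [IsFiniteMeasure μ] (w : Paths G v₀) (n : ℕ) (e : V → Paths G v₀)
    (he : ∀ y ∈ G.neighborFinset (proj w n), (∀ k ≤ n, (e y).1 k = w.1 k) ∧
      proj (e y) (n + 1) = y) :
    μ.real (pathCylinder w n) =
      ∑ y ∈ G.neighborFinset (proj w n), μ.real (pathCylinder (e y) (n + 1)) := by
  rw [← measureReal_biUnion_finset]
  · congr 1
    ext z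
    simp only [Set.mem_iUnion, exists_prop]
    constructor
    · intro hz
      have hy : proj z (n + 1) ∈ G.neighborFinset (proj w n) := by
        have h1 := z.2 n
        rw [hz n le_rfl] at h1
        exact (SimpleGraph.mem_neighborFinset ..).2 h1
      obtain ⟨h1, h2⟩ := he _ hy
      refine ⟨_, hy, fun k hk => ?_⟩
      rcases Nat.le_succ_iff_eq_or_le.1 hk with rfl | hk
      · exact Subtype.ext h2.symm
      · exact (hz k hk).trans (h1 k hk).symm
    · rintro ⟨y, hy, hz⟩ k hk
      exact (hz k (by omega)).trans ((he y hy).1 k hk)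
  · intro a ha b hb hab
    refine Set.disjoint_left.2 fun z hza hzb => hab ?_
    rw [← (he a ha).2, ← (he b hb).2]
    exact congrArg Subtype.val ((hza (n + 1) le_rfl).symm.trans (hzb (n + 1) le_rfl))
  · exact fun y _ => measurableSet_pathCylinder _ _

open Classical in
/-- The density of `ν` with respect to `μ` on the finite paths that end at `x`. -/
noncomputable def pathDensity (ν μ : Measure (Paths G v₀)) (n : ℕ) (x : V) : ℝ :=
  if h : ∃ w : Paths G v₀, proj w n = x then
    ν.real (pathCylinder h.choose n) / μ.real (pathCylinder h.choose n)
  else 0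

/-- Centrality of both measures makes the quotient independent of the path chosen to reach the
vertex. -/
theorem pathDensity_proj {ν μ : Measure (Paths G v₀)} (hν : IsCentral ν) (hμ : IsCentral μ)
    (w : Paths G v₀) (n : ℕ) :
    pathDensity ν μ n (proj w n) = ν.real (pathCylinder w n) / μ.real (pathCylinder w n) := by
  have h : ∃ w' : Paths G v₀, proj w' n = proj w n := ⟨w, rfl⟩
  have h' : h.choose.1 n = w.1 n := Subtype.ext h.choose_spec
  rw [pathDensity, dif_pos h, measureReal_def, measureReal_def, hν.uniform n _ _ h',
    hμ.uniform n _ _ h']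
  rfl

end Extension

/-! ### Ergodicity for r ≥ 1/2. -/

section Ergodic

variable {V : Type u} {G : SimpleGraph V} [G.LocallyFinite] {q : ℕ}
  (hG : IsHomogeneousTree G q) (hq : 2 ≤ q) (v₀ : V) (ω : Ends G) (r : unitInterval)

omit [G.LocallyFinite] in
theorem toReal_transProb_pos (hr0 : 0 < (r : ℝ)) (hr1 : (r : ℝ) < 1) (hq : 2 ≤ q) {x y : V}
    (hxy : G.Adj x y) : 0 < (transProb q ω r x y).toReal := by
  classical
  have hq0 : (0 : ℝ) < q := by positivity
  have h1 : (0 : ℝ) < 1 - r := by linarith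
  rw [transProb, if_pos hxy]
  split_ifs
  · rwa [ENNReal.toReal_ofReal hr0.le]
  · rw [ENNReal.toReal_ofReal (by positivity)]
    positivity

theorem measureReal_pathCylinder_pos (hr0 : 0 < (r : ℝ)) (hr1 : (r : ℝ) < 1) (w : Paths G v₀)
    (n : ℕ) : 0 < (markovMeasure hG hq v₀ ω r).real (pathCylinder w n) := by
  rw [measureReal_pathCylinder]
  exact Finset.prod_pos fun k _ => toReal_transProb_pos ω r hr0 hr1 hq (w.2 k)

theorem measureReal_pathCylinder_extension {w w' : Paths G v₀} {n : ℕ}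
    (h : ∀ k ≤ n, w'.1 k = w.1 k) :
    (markovMeasure hG hq v₀ ω r).real (pathCylinder w' (n + 1)) =
      (markovMeasure hG hq v₀ ω r).real (pathCylinder w n) *
        (transProb q ω r (proj w n) (proj w' (n + 1))).toReal := by
  have hp : ∀ k ≤ n, proj w' k = proj w k := fun k hk => congrArg Subtype.val (h k hk)
  rw [measureReal_pathCylinder, measureReal_pathCylinder, Finset.prod_range_succ, hp n le_rfl]
  congr 1
  refine Finset.prod_congr rfl fun k hk => ?_
  rw [Finset.mem_range] at hk
  rw [hp k hk.le, hp (k + 1) hk]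

/-- The density of a central measure with respect to the Markov measure is a space-time harmonic
function. -/
theorem pathDensity_eq_transMean (hr0 : 0 < (r : ℝ)) (hr1 : (r : ℝ) < 1)
    {ν : Measure (Paths G v₀)} (hν : IsCentral ν) {n : ℕ} {x : V} (hx : x ∈ levelSet G v₀ n) :
    pathDensity ν (markovMeasure hG hq v₀ ω r) n x = transMean hG.isTree q ω r
      (pathDensity ν (markovMeasure hG hq v₀ ω r) (n + 1)) x := by
  have := hν.prob
  set μ := markovMeasure hG hq v₀ ω r with hμ
  have hμc : IsCentral μ := isCentral_markovMeasure hG hq v₀ ω r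
  obtain ⟨w, rfl⟩ := exists_path_proj_eq hG.isTree ω hx
  have hex : ∀ y, ∃ w' : Paths G v₀, y ∈ G.neighborFinset (proj w n) →
      (∀ k ≤ n, w'.1 k = w.1 k) ∧ proj w' (n + 1) = y := by
    intro y
    by_cases hy : y ∈ G.neighborFinset (proj w n)
    · obtain ⟨w', h⟩ := exists_extension hG.isTree ω w n (y := y) (by simpa using hy)
      exact ⟨w', fun _ => h⟩
    · exact ⟨w, fun h => absurd h hy⟩
  choose e he using hex
  -- The mass of `ν` splits over the one-step extensions, and each extension multiplies the mass of
  -- `μ` by the transition probability; dividing gives the weighted mean of the densities.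
  rw [pathDensity_proj hν hμc, measureReal_pathCylinder_eq_sum ν w n e he, transMean_eq_sum,
    Finset.sum_div]
  refine Finset.sum_congr rfl fun y hy => ?_
  obtain ⟨h1, h2⟩ := he y hy
  have h3 := pathDensity_proj hν hμc (e y) (n + 1)
  have h4 := measureReal_pathCylinder_extension hG hq v₀ ω r h1
  have h5 := measureReal_pathCylinder_pos hG hq v₀ ω r hr0 hr1 w n
  have h6 := toReal_transProb_pos ω r hr0 hr1 hq (x := proj w n) (y := y) (by simpa using hy)
  rw [← hμ] at h4 h5
  rw [h2] at h3 h4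
  rw [h3, h4]
  field_simp

/-- A central measure dominated by a multiple of the Markov measure is the Markov measure, if the
drift towards `ω` is nonnegative. -/
theorem eq_markovMeasure_of_le (hr : (1 / 2 : ℝ) ≤ r) {ν : Measure (Paths G v₀)}
    (hν : IsCentral ν) {C : ℝ} (hC : ∀ s, ν.real s ≤ C * (markovMeasure hG hq v₀ ω r).real s) :
    ν = markovMeasure hG hq v₀ ω r := by
  have := hν.prob
  set μ := markovMeasure hG hq v₀ ω r with hμ
  have hμc : IsCentral μ := isCentral_markovMeasure hG hq v₀ ω r
  refine ext_of_pathCylinder fun w n => ?_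
  rw [← ENNReal.toReal_eq_toReal_iff' (measure_ne_top _ _) (measure_ne_top _ _)]
  change ν.real _ = μ.real _
  -- For r < 1 all finite paths have positive mass, and the bounded density is constant along edges,
  -- starting from 1 at the root. For r = 1 each cylinder has mass 0 or 1, and the domination
  -- applied to the cylinder or to its complement settles the value for `ν`.
  rcases r.2.2.lt_or_eq with hr1 | hr1
  · have hr0 : (0 : ℝ) < r := by linarith
    have hpos := measureReal_pathCylinder_pos hG hq v₀ ω r hr0 hr1
    have hbound : ∀ n x, x ∈ levelSet G v₀ n → |pathDensity ν μ n x| ≤ C := by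
      intro n x hx
      obtain ⟨w, rfl⟩ := exists_path_proj_eq hG.isTree ω hx
      rw [pathDensity_proj hν hμc, abs_of_nonneg (by positivity), div_le_iff₀ (hpos w n)]
      exact hC _
    have hone : ∀ n, pathDensity ν μ n (proj w n) = 1 := by
      intro n
      induction n with
      | zero =>
        have huniv : pathCylinder w 0 = Set.univ := by
          refine Set.eq_univ_of_forall fun z k hk => ?_
          obtain rfl : k = 0 := by omega
          exact Subtype.ext ((z.1 0).eq_base.trans (w.1 0).eq_base.symm)
        rw [pathDensity_proj hν hμc, huniv]
        simp
      | succ n ih =>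
        rw [← ih]
        exact eq_of_adj_of_parabolic hG hq hr hr1 hbound
          (fun n x hx => pathDensity_eq_transMean hG hq v₀ ω r hr0 hr1 hν hx) (w.1 n).2 (w.2 n)
    have h := hone n
    rw [pathDensity_proj hν hμc] at h
    exact (div_eq_one_iff_eq (hpos w n).ne').1 h
  · have h01 : μ.real (pathCylinder w n) = 0 ∨ μ.real (pathCylinder w n) = 1 := by
      obtain ⟨a, c, -, -, h⟩ := exists_prod_transProb_eq v₀ ω r hG.isTree q w n
      rw [hμ, measureReal_pathCylinder, h, hr1]
      rcases Nat.eq_zero_or_pos c with rfl | hc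
      · right
        simp
      · left
        simp [hc.ne']
    rcases h01 with h | h
    · have h1 := hC (pathCylinder w n)
      rw [h, mul_zero] at h1
      rw [h]
      exact le_antisymm h1 measureReal_nonneg
    · have hm := measurableSet_pathCylinder w n
      have h1 := hC (pathCylinder w n)ᶜ
      rw [probReal_compl_eq_one_sub hm, probReal_compl_eq_one_sub hm, h, sub_self, mul_zero] at h1
      rw [h]
      exact le_antisymm measureReal_le_one (by linarith)

/-- A component of weight `a` in a convex decomposition is dominated by `a⁻¹` times the whole, so
`eq_markovMeasure_of_le` identifies it. -/
theorem isErgodic_markovMeasure (hr : (1 / 2 : ℝ) ≤ r) :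
    IsErgodic (markovMeasure hG hq v₀ ω r) := by
  refine mem_extremePoints_iff_left.2 ⟨isCentral_markovMeasure hG hq v₀ ω r, ?_⟩
  rintro ν hν ν' hν' ⟨a, b, ha, hb, -, h⟩
  have hν₁ : IsCentral ν := hν
  have := hν₁.prob
  refine eq_markovMeasure_of_le hG hq v₀ ω r hr hν₁ (C := (a : ℝ)⁻¹) fun s => ?_
  have ha' : (0 : ℝ) < a := ha
  rw [le_inv_mul_iff₀ ha']
  have hle : (a : ℝ≥0∞) * ν s ≤ markovMeasure hG hq v₀ ω r s := by
    rw [← h, Measure.add_apply, Measure.smul_apply, ENNReal.smul_def, smul_eq_mul]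
    exact le_self_add
  have := ENNReal.toReal_mono (measure_ne_top _ _) hle
  rwa [ENNReal.toReal_mul, ENNReal.coe_toReal] at this

end Ergodic

end DynamicGraph

theorem proposition2 {V : Type*} (G : SimpleGraph V) [G.LocallyFinite] (q : ℕ) (hq : 2 ≤ q)
    (hG : DynamicGraph.IsHomogeneousTree G q) (v₀ : V) (ω : DynamicGraph.Ends G)
    (r : unitInterval) :
    -- the measure is central
    DynamicGraph.IsCentral (DynamicGraph.markovMeasure hG hq v₀ ω r) ∧
    -- it is ergodic exactly for `r ∈ [1/2, 1]`
    (DynamicGraph.IsErgodic (DynamicGraph.markovMeasure hG hq v₀ ω r) ↔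
      (r : ℝ) ∈ Set.Icc (1 / 2) 1) ∧
    -- for `r < 1/2`, almost every path converges to a random end other than `ω`, whose law
    -- is continuous, i.e. has no atoms
    ((r : ℝ) < 1 / 2 →
      ∃ X : DynamicGraph.Paths G v₀ → DynamicGraph.Ends G, Measurable X ∧
        (∀ᵐ w ∂(DynamicGraph.markovMeasure hG hq v₀ ω r),
          DynamicGraph.ConvergesTo (DynamicGraph.proj w) (X w) ∧ X w ≠ ω) ∧
        ∀ ξ, (DynamicGraph.markovMeasure hG hq v₀ ω r).map X {ξ} = 0) ∧
    -- for `r ≥ 1/2`, almost every path converges to `ω` with rate `2 r - 1`; here `ρ` is the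
    -- geodesic ray from `v₀` to `ω`
    ((1 / 2 : ℝ) ≤ r →
      (∀ᵐ w ∂(DynamicGraph.markovMeasure hG hq v₀ ω r),
        DynamicGraph.ConvergesTo (DynamicGraph.proj w) ω) ∧
      ∀ ρ : DynamicGraph.Ray G, ρ.Represents ω → ρ 0 = v₀ →
        ∀ᵐ w ∂(DynamicGraph.markovMeasure hG hq v₀ ω r),
          Tendsto (fun n : ℕ =>
            (G.dist (DynamicGraph.proj w n) (ρ ⌊(2 * (r : ℝ) - 1) * n⌋₊) : ℝ) / n)
            atTop (𝓝 0)) := by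
  refine ⟨DynamicGraph.isCentral_markovMeasure hG hq v₀ ω r, ⟨fun herg => ⟨?_, r.2.2⟩,
    fun hr => DynamicGraph.isErgodic_markovMeasure hG hq v₀ ω r hr.1⟩, fun hr =>
    ⟨DynamicGraph.limitEnd hG v₀ ω, DynamicGraph.measurable_limitEnd hG v₀ ω, ?_,
      DynamicGraph.map_limitEnd_singleton hG hq v₀ ω r hr⟩, fun hr =>
    ⟨DynamicGraph.ae_convergesTo_of_half_le hG hq v₀ ω r hr, fun ρ hρ h0 =>
      DynamicGraph.ae_tendsto_dist_div hG hq v₀ ω r hr hρ h0⟩⟩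
  · by_contra! hr
    exact DynamicGraph.not_isErgodic_markovMeasure hG hq v₀ ω r hr herg
  · filter_upwards [DynamicGraph.ae_tendsto_height_proj_atBot hG hq v₀ ω r hr] with w hw
    exact ⟨(DynamicGraph.limitEnd_spec hG hw).2.1, (DynamicGraph.limitEnd_spec hG hw).1⟩
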